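/- Let $n\ge 2$ and $1\le k\le n-1$. Let $\mathrm{GL}_k\times\mathrm{GL}_{n-k}\subset \mathrm{GL}_n(\mathbb R)$ and $\mathrm{O}_k\times\mathrm{O}_{n-k}\subset \mathrm{O}_n$ be the subgroups of block diagonal matrices, and equip $Y=\mathrm{GL}_n(\mathbb R)/(\mathrm{GL}_k\times\mathrm{GL}_{n-k})$ and $X=\mathrm{O}_n/(\mathrm{O}_k\times\mathrm{O}_{n-k})$ with their canonical real analytic manifold structures (those on the quotient topological spaces for which the quotient maps from $\mathrm{GL}_n(\mathbb R)$ and $\mathrm{O}_n$ are analytic submersions). Let $\upsilon:Y\to X$ be the map induced by the Gram–Schmidt process on the columns of matrices. Let $P_k$ be the diagonal matrix whose first $k$ diagonal entries are $1$ and whose other entries are $0$. The map $[W]\mapsto WP_kW^{-1}$ is injective on $Y$, and for $x=[V]\in X$ it maps the fibre $\upsilon^{-1}(x)$ onto the set of idempotent matrices with the same range as the orthogonal projection $VP_kV^{T}$ (an affine space of matrices). Let $\upsilon^{-1}(x)$ carry the real vector space structure induced from this affine space with $VP_kV^{T}$ as origin. Then: 1. $(Y,X,\upsilon)$ is a locally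 trivial real analytic vector bundle: $X$ and $Y$ are Hausdorff analytic manifolds, $\upsilon$ is an analytic surjection, and around all points of $X$ there are bi-analytic, fibrewise linear local trivialisations with model fibre $\mathbb R^{(n-k)\times k}$, whose transition functions are analytic as operator-valued maps. 2. There is a bi-analytic bijection $\Phi$ from the total space of the tangent bundle $TX$ onto $Y$ such that $\upsilon\circ\Phi$ is the bundle projection $TX\to X$ and such that $\Phi$ restricts, for every $x\in X$, to a linear map $T_xX\to\upsilon^{-1}(x)$. -/

import Mathlib

open scoped Manifold ContDiff Matrix Topology

namespace GramSchmidtBundle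

/-! ### The groups and the homogeneous spaces -/

/-- The lower left block (rows of index `≥ k`, columns of index `< k`) vanishes. -/
def IsBlockUpper {n : ℕ} (k : ℕ) (M : Matrix (Fin n) (Fin n) ℝ) : Prop :=
  ∀ i j : Fin n, ¬ i.1 < k → j.1 < k → M i j = 0

/-- `M` is block diagonal with one block of size `k` and one of size `n - k`: both off-diagonal
blocks vanish. -/
def IsBlockDiag {n : ℕ} (k : ℕ) (M : Matrix (Fin n) (Fin n) ℝ) : Prop :=
  ∀ i j : Fin n, ¬ (i.1 < k ↔ j.1 < k) → M i j = 0

theorem isBlockDiag_iff {n : ℕ} {k : ℕ} {M : Matrix (Fin n) (Fin n) ℝ} :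
    IsBlockDiag k M ↔ IsBlockUpper k M ∧ IsBlockUpper k Mᵀ := by
  constructor
  · intro h
    exact ⟨fun i j hi hj => h i j (by tauto), fun i j hi hj => h j i (by tauto)⟩
  · rintro ⟨h1, h2⟩ i j hij
    by_cases hi : i.1 < k
    · exact h2 j i (by tauto) hi
    · exact h1 i j hi (by tauto)

theorem isBlockUpper_iff {n : ℕ} {k : ℕ} {M : Matrix (Fin n) (Fin n) ℝ} :
    IsBlockUpper k M ↔ M.BlockTriangular (fun i : Fin n => decide (k ≤ i.1)) := by
  constructor
  · intro h i j hij
    rw [Bool.lt_iff] at hij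
    simp only [decide_eq_false_iff_not, decide_eq_true_eq] at hij
    exact h i j (by omega) (by omega)
  · intro h i j hi hj
    refine h ?_
    rw [Bool.lt_iff]
    simp only [decide_eq_false_iff_not, decide_eq_true_eq]
    omega

theorem IsBlockUpper.mul {n : ℕ} {k : ℕ} {M N : Matrix (Fin n) (Fin n) ℝ}
    (hM : IsBlockUpper k M) (hN : IsBlockUpper k N) : IsBlockUpper k (M * N) :=
  isBlockUpper_iff.2 ((isBlockUpper_iff.1 hM).mul (isBlockUpper_iff.1 hN))

theorem IsBlockUpper.inv {n : ℕ} {k : ℕ} (g : GL (Fin n) ℝ) (h : IsBlockUpper k g.1) :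
    IsBlockUpper k (g⁻¹).1 := by
  have : Invertible g.1 := g.invertible
  have := Matrix.blockTriangular_inv_of_blockTriangular (isBlockUpper_iff.1 h)
  rw [Matrix.coe_units_inv]
  exact isBlockUpper_iff.2 this

theorem isBlockUpper_one {n : ℕ} {k : ℕ} : IsBlockUpper k (1 : Matrix (Fin n) (Fin n) ℝ) :=
  fun i j hi hj => Matrix.one_apply_ne (by rintro rfl; exact hi hj)

theorem IsBlockDiag.inv {n : ℕ} {k : ℕ} (g : GL (Fin n) ℝ) (h : IsBlockDiag k g.1) :
    IsBlockDiag k (g⁻¹).1 := by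
  obtain ⟨h1, h2⟩ := isBlockDiag_iff.1 h
  refine isBlockDiag_iff.2 ⟨h1.inv, ?_⟩
  let g' : GL (Fin n) ℝ := ⟨g.1ᵀ, (g⁻¹).1ᵀ, by
    rw [← Matrix.transpose_mul, Units.inv_mul, Matrix.transpose_one], by
    rw [← Matrix.transpose_mul, Units.mul_inv, Matrix.transpose_one]⟩
  exact IsBlockUpper.inv g' h2

/-- The subgroup `GL_k × GL_{n-k}` of `GL_n(ℝ)`: the invertible block diagonal matrices. -/
def blockGL (n k : ℕ) : Subgroup (GL (Fin n) ℝ) where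
  carrier := {g | IsBlockDiag k g.1}
  one_mem' := isBlockDiag_iff.2 ⟨isBlockUpper_one, by
    simpa using isBlockUpper_one⟩
  mul_mem' := by
    intro a b ha hb
    obtain ⟨a1, a2⟩ := isBlockDiag_iff.1 ha
    obtain ⟨b1, b2⟩ := isBlockDiag_iff.1 hb
    refine isBlockDiag_iff.2 ⟨a1.mul b1, ?_⟩
    rw [Units.val_mul, Matrix.transpose_mul]
    exact b2.mul a2
  inv_mem' := fun {g} h => IsBlockDiag.inv g h

/-- The subgroup `O_k × O_{n-k}` of `O_n`: the block diagonal orthogonal matrices. -/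
def blockO (n k : ℕ) : Subgroup (Matrix.orthogonalGroup (Fin n) ℝ) :=
  (blockGL n k).comap Unitary.toUnits

/-- The homogeneous space `GL_n(ℝ) / (GL_k × GL_{n-k})`, with the quotient topology. -/
abbrev GLQuot (n k : ℕ) : Type := GL (Fin n) ℝ ⧸ blockGL n k

/-- The homogeneous space `O_n / (O_k × O_{n-k})`, with the quotient topology. -/
abbrev OQuot (n k : ℕ) : Type := Matrix.orthogonalGroup (Fin n) ℝ ⧸ blockO n k

/-! ### The Gram-Schmidt map -/

/-- The columns of a matrix, as vectors of the Euclidean space. -/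
def colVec {n : ℕ} (W : Matrix (Fin n) (Fin n) ℝ) (j : Fin n) : EuclideanSpace ℝ (Fin n) :=
  WithLp.toLp 2 (fun i => W i j)

/-- The matrix obtained by applying the (normalised) Gram-Schmidt process to the columns. -/
noncomputable def gsMatrix {n : ℕ} (W : Matrix (Fin n) (Fin n) ℝ) : Matrix (Fin n) (Fin n) ℝ :=
  Matrix.of fun i j => InnerProductSpace.gramSchmidtNormed ℝ (colVec W) j i

theorem linearIndependent_colVec {n : ℕ} (W : GL (Fin n) ℝ) :
    LinearIndependent ℝ (colVec W.1) := by
  have h : LinearIndependent ℝ W.1.col :=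
    Matrix.linearIndependent_cols_of_isUnit W.isUnit
  exact h.map' (WithLp.linearEquiv 2 ℝ (Fin n → ℝ)).symm.toLinearMap
    (LinearEquiv.ker _)

theorem inner_eq_sum {n : ℕ} (x y : EuclideanSpace ℝ (Fin n)) :
    inner ℝ x y = ∑ i, x i * y i := by
  simp [PiLp.inner_apply, mul_comm]

theorem gsMatrix_mem {n : ℕ} (W : GL (Fin n) ℝ) :
    gsMatrix W.1 ∈ Matrix.orthogonalGroup (Fin n) ℝ := by
  rw [Matrix.mem_orthogonalGroup_iff']
  have h := InnerProductSpace.gramSchmidtNormed_orthonormal (linearIndependent_colVec W)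
  rw [orthonormal_iff_ite] at h
  ext i j
  rw [Matrix.one_apply, ← h i j, inner_eq_sum]
  rfl

/-- The Gram-Schmidt map `GL_n(ℝ) → O_n`, acting on the columns of matrices. -/
noncomputable def gramSchmidtGL {n : ℕ} (W : GL (Fin n) ℝ) : Matrix.orthogonalGroup (Fin n) ℝ :=
  ⟨gsMatrix W.1, gsMatrix_mem W⟩

theorem toUnits_val {n : ℕ} (V : Matrix.orthogonalGroup (Fin n) ℝ) :
    (Unitary.toUnits V).1 = V.1 := rfl

theorem toUnits_inv_val {n : ℕ} (V : Matrix.orthogonalGroup (Fin n) ℝ) :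
    ((Unitary.toUnits V)⁻¹).1 = V.1ᵀ := rfl

theorem orthogonal_isBlockDiag {n k : ℕ} (V : Matrix.orthogonalGroup (Fin n) ℝ)
    (h : IsBlockUpper k V.1) : V ∈ blockO n k := by
  refine isBlockDiag_iff.2 ⟨h, ?_⟩
  exact IsBlockUpper.inv (Unitary.toUnits V) h

/-- The triangular factor `Vᵀ W` of `W`, where `V` is the Gram-Schmidt matrix of `W`. -/
theorem isBlockUpper_gs {n : ℕ} (k : ℕ) (W : GL (Fin n) ℝ) :
    IsBlockUpper k ((Unitary.toUnits (gramSchmidtGL W))⁻¹ * W).1 := by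
  intro i j hi hj
  have h := InnerProductSpace.gramSchmidt_inv_triangular ℝ (colVec W.1)
    (i := j) (j := i) (by rw [Fin.lt_def]; omega)
  have h' : inner ℝ (InnerProductSpace.gramSchmidtNormed ℝ (colVec W.1) i) (colVec W.1 j) = 0 := by
    rw [InnerProductSpace.gramSchmidtNormed, inner_smul_left, h, mul_zero]
  rw [inner_eq_sum] at h'
  exact h'

theorem gs_wellDefined {n k : ℕ} (W W' : GL (Fin n) ℝ) (h : IsBlockUpper k (W⁻¹ * W').1) :
    (QuotientGroup.mk (gramSchmidtGL W) : OQuot n k) = QuotientGroup.mk (gramSchmidtGL W') := by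
  rw [QuotientGroup.eq]
  apply orthogonal_isBlockDiag
  have e : ((gramSchmidtGL W)⁻¹ * gramSchmidtGL W').1 =
      (((Unitary.toUnits (gramSchmidtGL W))⁻¹ * W) * (W⁻¹ * W') *
        ((Unitary.toUnits (gramSchmidtGL W'))⁻¹ * W')⁻¹).1 := by
    have : ((Unitary.toUnits (gramSchmidtGL W))⁻¹ * W) * (W⁻¹ * W') *
        ((Unitary.toUnits (gramSchmidtGL W'))⁻¹ * W')⁻¹ =
        Unitary.toUnits ((gramSchmidtGL W)⁻¹ * gramSchmidtGL W') := by
      rw [map_mul, map_inv]; group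
    rw [this]; rfl
  rw [e]
  exact ((isBlockUpper_gs k W).mul h).mul (IsBlockUpper.inv _ (isBlockUpper_gs k W'))

/-- The Gram-Schmidt map `υ : GL_n(ℝ) / (GL_k × GL_{n-k}) → O_n / (O_k × O_{n-k})`, induced by the
Gram-Schmidt map `GL_n(ℝ) → O_n`. -/
noncomputable def gramSchmidtMap (n k : ℕ) : GLQuot n k → OQuot n k :=
  Quotient.lift (fun W => (QuotientGroup.mk (gramSchmidtGL W) : OQuot n k)) (by
    intro W W' h
    have h' := QuotientGroup.leftRel_apply.1 h
    exact gs_wellDefined W W' (isBlockDiag_iff.1 h').1)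

/-! ### The idempotents -/

/-- The diagonal matrix `P_k` whose first `k` diagonal entries are `1`, the others being `0`. -/
def diagProj (n k : ℕ) : Matrix (Fin n) (Fin n) ℝ :=
  Matrix.diagonal fun i => if i.1 < k then 1 else 0

theorem diagProj_comm {n k : ℕ} {M : Matrix (Fin n) (Fin n) ℝ} (h : IsBlockDiag k M) :
    M * diagProj n k = diagProj n k * M := by
  ext i j
  rw [diagProj, Matrix.mul_diagonal, Matrix.diagonal_mul]
  by_cases hij : (i.1 < k ↔ j.1 < k)
  · simp [hij, mul_comm]
  · simp [h i j hij]

/-- The injection `[W] ↦ W P_k W⁻¹` of `GL_n(ℝ) / (GL_k × GL_{n-k})` into the set of idempotent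
matrices. -/
def idem (n k : ℕ) : GLQuot n k → Matrix (Fin n) (Fin n) ℝ :=
  Quotient.lift (fun W => W.1 * diagProj n k * (W⁻¹).1) (by
    intro W W' h
    have h' := diagProj_comm (QuotientGroup.leftRel_apply.1 h)
    have e : W'.1 = W.1 * (W⁻¹ * W').1 := by simp
    have e' : (W'⁻¹).1 = (W⁻¹ * W')⁻¹.1 * (W⁻¹).1 := by simp
    have e3 : W.1 * (W⁻¹ * W').1 * diagProj n k * ((W⁻¹ * W')⁻¹.1 * (W⁻¹).1) =
        W.1 * ((W⁻¹ * W').1 * diagProj n k) * ((W⁻¹ * W')⁻¹.1 * (W⁻¹).1) := by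
      simp only [Matrix.mul_assoc]
    show W.1 * diagProj n k * (W⁻¹).1 = W'.1 * diagProj n k * (W'⁻¹).1
    rw [e', e, e3, h']
    simp only [Matrix.mul_assoc]
    rw [← Matrix.mul_assoc (W⁻¹ * W').1, Units.mul_inv, Matrix.one_mul])

/-- The map `[V] ↦ V P_k Vᵀ` sending a point of `O_n / (O_k × O_{n-k})` to the orthogonal projection
onto the span of the first `k` columns of `V`. -/
def orthProj (n k : ℕ) : OQuot n k → Matrix (Fin n) (Fin n) ℝ :=
  Quotient.lift (fun V => V.1 * diagProj n k * V.1ᵀ) (by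
    intro V V' h
    have h' : (Unitary.toUnits V)⁻¹ * Unitary.toUnits V' ∈ blockGL n k := by
      have := QuotientGroup.leftRel_apply.1 h
      rw [← map_inv, ← map_mul]
      exact this
    have := congrArg (idem n k) (QuotientGroup.eq.2 h')
    exact this)

end GramSchmidtBundle

namespace GramSchmidtBundle

/-! ### The analytic structures of the homogeneous spaces -/

/-- The indices of the first block. -/
abbrev LowIdx (n k : ℕ) : Type := {i : Fin n // i.1 < k}

/-- The indices of the second block. -/
abbrev HighIdx (n k : ℕ) : Type := {i : Fin n // ¬ i.1 < k}

/-- The model space of `O_n / (O_k × O_{n-k})`: real `(n-k) × k` arrays. -/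
abbrev ModelO (n k : ℕ) : Type := HighIdx n k → LowIdx n k → ℝ

/-- The model space of `GL_n(ℝ) / (GL_k × GL_{n-k})`: pairs of an `(n-k) × k` array and a
`k × (n-k)` array. -/
abbrev ModelGL (n k : ℕ) : Type := ModelO n k × (LowIdx n k → HighIdx n k → ℝ)

/-- The upper left block. -/
def blkA {n : ℕ} (k : ℕ) (M : Matrix (Fin n) (Fin n) ℝ) : Matrix (LowIdx n k) (LowIdx n k) ℝ :=
  M.toBlock (fun i => i.1 < k) (fun i => i.1 < k)

/-- The upper right block. -/
def blkB {n : ℕ} (k : ℕ) (M : Matrix (Fin n) (Fin n) ℝ) : Matrix (LowIdx n k) (HighIdx n k) ℝ :=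
  M.toBlock (fun i => i.1 < k) (fun i => ¬ i.1 < k)

/-- The lower left block. -/
def blkC {n : ℕ} (k : ℕ) (M : Matrix (Fin n) (Fin n) ℝ) : Matrix (HighIdx n k) (LowIdx n k) ℝ :=
  M.toBlock (fun i => ¬ i.1 < k) (fun i => i.1 < k)

/-- The lower right block. -/
def blkD {n : ℕ} (k : ℕ) (M : Matrix (Fin n) (Fin n) ℝ) : Matrix (HighIdx n k) (HighIdx n k) ℝ :=
  M.toBlock (fun i => ¬ i.1 < k) (fun i => ¬ i.1 < k)

/-- `C A⁻¹`, for a matrix with blocks `A B` over `C D`. -/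
noncomputable def slopeLow {n : ℕ} (k : ℕ) (M : Matrix (Fin n) (Fin n) ℝ) : ModelO n k :=
  blkC k M * (blkA k M)⁻¹

/-- `B D⁻¹`, for a matrix with blocks `A B` over `C D`. -/
noncomputable def slopeHigh {n : ℕ} (k : ℕ) (M : Matrix (Fin n) (Fin n) ℝ) :
    LowIdx n k → HighIdx n k → ℝ :=
  blkB k M * (blkD k M)⁻¹

/-- The matrix with blocks `1 S` over `T 1`. -/
def glue {n k : ℕ} (p : ModelGL n k) : Matrix (Fin n) (Fin n) ℝ :=
  Matrix.of fun i j =>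
    if hi : i.1 < k then
      if hj : j.1 < k then if i = j then 1 else 0 else p.2 ⟨i, hi⟩ ⟨j, hj⟩
    else
      if hj : j.1 < k then p.1 ⟨i, hi⟩ ⟨j, hj⟩ else if i = j then 1 else 0

theorem blkA_glue {n k : ℕ} (p : ModelGL n k) : blkA k (glue p) = 1 := by
  ext ⟨i, hi⟩ ⟨j, hj⟩
  simp [blkA, glue, hi, hj, Matrix.one_apply]

theorem blkB_glue {n k : ℕ} (p : ModelGL n k) : blkB k (glue p) = p.2 := by
  ext ⟨i, hi⟩ ⟨j, hj⟩
  simp [blkB, glue, hi, hj]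

theorem blkC_glue {n k : ℕ} (p : ModelGL n k) : blkC k (glue p) = p.1 := by
  ext ⟨i, hi⟩ ⟨j, hj⟩
  simp [blkC, glue, hi, hj]

theorem blkD_glue {n k : ℕ} (p : ModelGL n k) : blkD k (glue p) = 1 := by
  ext ⟨i, hi⟩ ⟨j, hj⟩
  simp [blkD, glue, hi, hj, Matrix.one_apply]

theorem blk_ext {n k : ℕ} {M N : Matrix (Fin n) (Fin n) ℝ} (hA : blkA k M = blkA k N)
    (hB : blkB k M = blkB k N) (hC : blkC k M = blkC k N) (hD : blkD k M = blkD k N) : M = N := by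
  ext i j
  by_cases hi : i.1 < k <;> by_cases hj : j.1 < k
  · exact congrFun (congrFun hA ⟨i, hi⟩) ⟨j, hj⟩
  · exact congrFun (congrFun hB ⟨i, hi⟩) ⟨j, hj⟩
  · exact congrFun (congrFun hC ⟨i, hi⟩) ⟨j, hj⟩
  · exact congrFun (congrFun hD ⟨i, hi⟩) ⟨j, hj⟩

section mul

variable {n k : ℕ} (M N : Matrix (Fin n) (Fin n) ℝ)

theorem blkA_mul : blkA k (M * N) = blkA k M * blkA k N + blkB k M * blkC k N :=
  Matrix.toBlock_mul_eq_add _ _ _ _ _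

theorem blkB_mul : blkB k (M * N) = blkA k M * blkB k N + blkB k M * blkD k N :=
  Matrix.toBlock_mul_eq_add _ _ _ _ _

theorem blkC_mul : blkC k (M * N) = blkC k M * blkA k N + blkD k M * blkC k N :=
  Matrix.toBlock_mul_eq_add _ _ _ _ _

theorem blkD_mul : blkD k (M * N) = blkC k M * blkB k N + blkD k M * blkD k N :=
  Matrix.toBlock_mul_eq_add _ _ _ _ _

variable {N}

theorem isBlockUpper_iff_blkC : IsBlockUpper k N ↔ blkC k N = 0 := by
  constructor
  · intro h; ext ⟨i, hi⟩ ⟨j, hj⟩; exact h i j hi hj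
  · intro h i j hi hj; exact congrFun (congrFun h ⟨i, hi⟩) ⟨j, hj⟩

theorem isBlockUpper_transpose_iff_blkB : IsBlockUpper k Nᵀ ↔ blkB k N = 0 := by
  constructor
  · intro h; ext ⟨i, hi⟩ ⟨j, hj⟩; exact h j i hj hi
  · intro h i j hi hj; exact congrFun (congrFun h ⟨j, hj⟩) ⟨i, hi⟩

theorem det_of_isBlockUpper (h : IsBlockUpper k N) :
    N.det = (blkA k N).det * (blkD k N).det :=
  Matrix.twoBlockTriangular_det N (fun i : Fin n => i.1 < k) (fun i hi j hj => h i j hi hj)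

theorem blkA_mul_upper (h : IsBlockUpper k N) : blkA k (M * N) = blkA k M * blkA k N := by
  rw [blkA_mul, isBlockUpper_iff_blkC.1 h, Matrix.mul_zero, add_zero]

theorem blkC_mul_upper (h : IsBlockUpper k N) : blkC k (M * N) = blkC k M * blkA k N := by
  rw [blkC_mul, isBlockUpper_iff_blkC.1 h, Matrix.mul_zero, add_zero]

theorem blkB_mul_lower (h : IsBlockUpper k Nᵀ) : blkB k (M * N) = blkB k M * blkD k N := by
  rw [blkB_mul, isBlockUpper_transpose_iff_blkB.1 h, Matrix.mul_zero, zero_add]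

theorem blkD_mul_lower (h : IsBlockUpper k Nᵀ) : blkD k (M * N) = blkD k M * blkD k N := by
  rw [blkD_mul, isBlockUpper_transpose_iff_blkB.1 h, Matrix.mul_zero, zero_add]

end mul

theorem det_blk_ne_zero {n k : ℕ} (g : GL (Fin n) ℝ) (h : IsBlockUpper k g.1) :
    (blkA k g.1).det ≠ 0 ∧ (blkD k g.1).det ≠ 0 := by
  have h1 : g.1.det ≠ 0 := (Matrix.isUnit_iff_isUnit_det _).1 g.isUnit |>.ne_zero
  rw [det_of_isBlockUpper h] at h1
  exact ⟨left_ne_zero_of_mul h1, right_ne_zero_of_mul h1⟩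

theorem slope_cancel {l m : Type} [Fintype l] [DecidableEq l] [Fintype m]
    (C : Matrix m l ℝ) (A a : Matrix l l ℝ) (ha : a.det ≠ 0) :
    C * a * (A * a)⁻¹ = C * A⁻¹ := by
  rw [Matrix.mul_inv_rev, Matrix.mul_assoc, ← Matrix.mul_assoc a,
    Matrix.mul_nonsing_inv _ (isUnit_iff_ne_zero.2 ha), Matrix.one_mul]

/-- Right multiplication by an invertible block upper triangular matrix changes neither the slope
`C A⁻¹` nor the condition `det A ≠ 0`. -/
theorem low_mul {n k : ℕ} (M : Matrix (Fin n) (Fin n) ℝ) (g : GL (Fin n) ℝ)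
    (h : IsBlockUpper k g.1) : slopeLow k (M * g.1) = slopeLow k M ∧
      ((blkA k (M * g.1)).det ≠ 0 ↔ (blkA k M).det ≠ 0) := by
  have hd := (det_blk_ne_zero g h).1
  constructor
  · rw [slopeLow, blkA_mul_upper _ h, blkC_mul_upper _ h]
    exact slope_cancel _ _ _ hd
  · rw [blkA_mul_upper _ h, Matrix.det_mul]
    simp [hd]

theorem high_mul {n k : ℕ} (M : Matrix (Fin n) (Fin n) ℝ) (g : GL (Fin n) ℝ)
    (h : IsBlockDiag k g.1) : slopeHigh k (M * g.1) = slopeHigh k M ∧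
      ((blkD k (M * g.1)).det ≠ 0 ↔ (blkD k M).det ≠ 0) := by
  obtain ⟨h1, h2⟩ := isBlockDiag_iff.1 h
  have hd := (det_blk_ne_zero g h1).2
  constructor
  · rw [slopeHigh, blkD_mul_lower _ h2, blkB_mul_lower _ h2]
    exact slope_cancel _ _ _ hd
  · rw [blkD_mul_lower _ h2, Matrix.det_mul]
    simp [hd]

/-! #### Continuity and analyticity of the block operations -/

theorem continuous_blkA {n k : ℕ} : Continuous (blkA (n := n) k) :=
  continuous_id.matrix_submatrix _ _
theorem continuous_blkB {n k : ℕ} : Continuous (blkB (n := n) k) :=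
  continuous_id.matrix_submatrix _ _
theorem continuous_blkC {n k : ℕ} : Continuous (blkC (n := n) k) :=
  continuous_id.matrix_submatrix _ _
theorem continuous_blkD {n k : ℕ} : Continuous (blkD (n := n) k) :=
  continuous_id.matrix_submatrix _ _

theorem continuous_glue {n k : ℕ} : Continuous (glue (n := n) (k := k)) := by
  refine continuous_matrix fun i j => ?_
  simp only [glue, Matrix.of_apply]
  split_ifs <;> fun_prop

theorem continuousAt_slope {X l m : Type} [TopologicalSpace X] [Fintype l] [DecidableEq l]
    {C : X → Matrix m l ℝ} {A : X → Matrix l l ℝ} (hC : Continuous C) (hA : Continuous A)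
    {x : X} (hx : (A x).det ≠ 0) : ContinuousAt (fun x => C x * (A x)⁻¹) x := by
  have h : ContinuousAt (fun x => C x * ((A x).det⁻¹ • (A x).adjugate)) x := by
    have h2 : ContinuousAt (fun x => (A x).det⁻¹ • (A x).adjugate) x :=
      (hA.matrix_det.continuousAt.inv₀ hx).smul hA.matrix_adjugate.continuousAt
    have hm : Continuous fun q : Matrix m l ℝ × Matrix l l ℝ => q.1 * q.2 :=
      continuous_fst.matrix_mul continuous_snd
    exact hm.continuousAt.comp (hC.continuousAt.prodMk h2)
  simpa only [Matrix.inv_def, Ring.inverse_eq_inv'] using h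

theorem contDiffAt_det {E l : Type} [NormedAddCommGroup E] [NormedSpace ℝ E] [Fintype l]
    [DecidableEq l] {A : E → Matrix l l ℝ} {x : E}
    (hA : ∀ i j, ContDiffAt ℝ ω (fun x => A x i j) x) :
    ContDiffAt ℝ ω (fun x => (A x).det) x := by
  simp only [Matrix.det_apply]
  refine ContDiffAt.sum fun σ _ => ?_
  refine ContDiffAt.const_smul _ ?_
  exact contDiffAt_prod fun i _ => hA _ _

theorem contDiffAt_slope {E l m : Type} [NormedAddCommGroup E] [NormedSpace ℝ E] [Fintype l]
    [DecidableEq l] [Fintype m] {C : E → Matrix m l ℝ} {A : E → Matrix l l ℝ} {x : E}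
    (hC : ∀ i j, ContDiffAt ℝ ω (fun x => C x i j) x)
    (hA : ∀ i j, ContDiffAt ℝ ω (fun x => A x i j) x) (hx : (A x).det ≠ 0) :
    ContDiffAt ℝ ω (F := m → l → ℝ) (fun x => C x * (A x)⁻¹) x := by
  refine contDiffAt_pi.2 fun i => contDiffAt_pi.2 fun j => ?_
  simp only [Matrix.mul_apply, Matrix.inv_def, Ring.inverse_eq_inv', Matrix.smul_apply,
    smul_eq_mul, Matrix.adjugate_apply]
  refine ContDiffAt.sum fun a _ => (hC i a).mul ?_
  refine ((contDiffAt_det hA).inv hx).mul (contDiffAt_det fun b c => ?_)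
  by_cases hb : b = j
  · subst hb
    simp only [Matrix.updateRow_self]
    exact contDiffAt_const
  · simp only [Matrix.updateRow_ne hb]
    exact hA b c

theorem contDiffAt_slopeLow {E : Type} [NormedAddCommGroup E] [NormedSpace ℝ E] {n k : ℕ}
    {X : E → Matrix (Fin n) (Fin n) ℝ} {x : E}
    (hX : ∀ i j, ContDiffAt ℝ ω (fun x => X x i j) x) (hx : (blkA k (X x)).det ≠ 0) :
    ContDiffAt ℝ ω (fun x => slopeLow k (X x)) x :=
  contDiffAt_slope (C := fun x => blkC k (X x)) (A := fun x => blkA k (X x))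
    (fun i j => hX i.1 j.1) (fun i j => hX i.1 j.1) hx

theorem contDiffAt_slopeHigh {E : Type} [NormedAddCommGroup E] [NormedSpace ℝ E] {n k : ℕ}
    {X : E → Matrix (Fin n) (Fin n) ℝ} {x : E}
    (hX : ∀ i j, ContDiffAt ℝ ω (fun x => X x i j) x) (hx : (blkD k (X x)).det ≠ 0) :
    ContDiffAt ℝ ω (fun x => slopeHigh k (X x)) x :=
  contDiffAt_slope (C := fun x => blkB k (X x)) (A := fun x => blkD k (X x))
    (fun i j => hX i.1 j.1) (fun i j => hX i.1 j.1) hx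

theorem contDiff_mul_glue {n k : ℕ} (X : Matrix (Fin n) (Fin n) ℝ) (i j : Fin n) :
    ContDiff ℝ ω (fun p : ModelGL n k => (X * glue p) i j) := by
  simp only [Matrix.mul_apply]
  refine ContDiff.sum fun a _ => contDiff_const.mul ?_
  simp only [glue, Matrix.of_apply]
  split_ifs
  · exact contDiff_const
  · exact contDiff_const
  · exact (contDiff_apply_apply ℝ ℝ _ _).comp contDiff_snd
  · exact (contDiff_apply_apply ℝ ℝ _ _).comp contDiff_fst
  · exact contDiff_const
  · exact contDiff_const

/-! #### Charts of `GL_n(ℝ) / (GL_k × GL_{n-k})` -/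

/-- The coordinates `[W] ↦ (C A⁻¹, B D⁻¹)`, where `W` has blocks `A B` over `C D`. -/
noncomputable def coordGL (n k : ℕ) : GLQuot n k → ModelGL n k :=
  Quotient.lift (fun W => (slopeLow k W.1, slopeHigh k W.1)) (by
    intro W W' h
    have h' : IsBlockDiag k (W⁻¹ * W').1 := QuotientGroup.leftRel_apply.1 h
    have e : W'.1 = W.1 * (W⁻¹ * W').1 := by simp
    show (slopeLow k W.1, slopeHigh k W.1) = (slopeLow k W'.1, slopeHigh k W'.1)
    rw [e, (low_mul _ _ (isBlockDiag_iff.1 h').1).1, (high_mul _ _ h').1])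

/-- The domain of `coordGL`: the diagonal blocks `A` and `D` are invertible. -/
def domGL (n k : ℕ) : Set (GLQuot n k) :=
  {x | Quotient.lift (fun W : GL (Fin n) ℝ => (blkA k W.1).det ≠ 0 ∧ (blkD k W.1).det ≠ 0) (by
    intro W W' h
    have h' : IsBlockDiag k (W⁻¹ * W').1 := QuotientGroup.leftRel_apply.1 h
    have e : W'.1 = W.1 * (W⁻¹ * W').1 := by simp
    show ((blkA k W.1).det ≠ 0 ∧ (blkD k W.1).det ≠ 0) =
      ((blkA k W'.1).det ≠ 0 ∧ (blkD k W'.1).det ≠ 0)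
    rw [e, (low_mul _ _ (isBlockDiag_iff.1 h').1).2, (high_mul _ _ h').2]) x}

/-- An invertible matrix, as an element of `GL_n(ℝ)` (by convention `1` for singular matrices). -/
noncomputable def toGL {n : ℕ} (M : Matrix (Fin n) (Fin n) ℝ) : GL (Fin n) ℝ := by
  classical
  exact if h : M.det ≠ 0 then Matrix.GeneralLinearGroup.mkOfDetNeZero M h else 1

theorem toGL_val {n : ℕ} {M : Matrix (Fin n) (Fin n) ℝ} (h : M.det ≠ 0) : (toGL M).1 = M := by
  rw [toGL, dif_pos h]; rfl

theorem continuousOn_toGL {n : ℕ} :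
    ContinuousOn (toGL (n := n)) {M | M.det ≠ 0} := by
  rw [continuousOn_iff_continuous_domRestrict, Units.continuous_iff]
  constructor
  · have : Units.val ∘ ({M : Matrix (Fin n) (Fin n) ℝ | M.det ≠ 0}).domRestrict toGL =
        Subtype.val := by
      ext M : 1; exact toGL_val M.2
    rw [this]; exact continuous_subtype_val
  · have : (fun M => ((({M : Matrix (Fin n) (Fin n) ℝ | M.det ≠ 0}).domRestrict toGL M)⁻¹).1) =
        fun M => M.1.det⁻¹ • M.1.adjugate := by
      ext M : 1
      rw [Matrix.coe_units_inv, Set.domRestrict_apply, toGL_val M.2, Matrix.inv_def,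
        Ring.inverse_eq_inv']
    rw [this]
    exact (continuous_subtype_val.matrix_det.inv₀ fun M => M.2).smul
      continuous_subtype_val.matrix_adjugate

theorem exists_glue {n k : ℕ} (W : GL (Fin n) ℝ) (hA : (blkA k W.1).det ≠ 0)
    (hD : (blkD k W.1).det ≠ 0) :
    (glue (slopeLow k W.1, slopeHigh k W.1)).det ≠ 0 ∧
      (toGL (glue (slopeLow k W.1, slopeHigh k W.1)))⁻¹ * W ∈ blockGL n k := by
  let N : Matrix (Fin n) (Fin n) ℝ := Matrix.of fun i j => if (i.1 < k ↔ j.1 < k) then W.1 i j else 0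
  have nA : blkA k N = blkA k W.1 := by ext ⟨i, hi⟩ ⟨j, hj⟩; simp [blkA, N, hi, hj]
  have nB : blkB k N = 0 := by ext ⟨i, hi⟩ ⟨j, hj⟩; simp [blkB, N, hi, hj]
  have nC : blkC k N = 0 := by ext ⟨i, hi⟩ ⟨j, hj⟩; simp [blkC, N, hi, hj]
  have nD : blkD k N = blkD k W.1 := by ext ⟨i, hi⟩ ⟨j, hj⟩; simp [blkD, N, hi, hj]
  have hN : IsBlockDiag k N :=
    isBlockDiag_iff.2 ⟨isBlockUpper_iff_blkC.2 nC, isBlockUpper_transpose_iff_blkB.2 nB⟩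
  set p : ModelGL n k := (slopeLow k W.1, slopeHigh k W.1) with hp
  have hT : (show Matrix (HighIdx n k) (LowIdx n k) ℝ from p.1) * blkA k W.1 = blkC k W.1 := by
    show blkC k W.1 * (blkA k W.1)⁻¹ * blkA k W.1 = _
    rw [Matrix.mul_assoc, Matrix.nonsing_inv_mul _ (isUnit_iff_ne_zero.2 hA), Matrix.mul_one]
  have hS : (show Matrix (LowIdx n k) (HighIdx n k) ℝ from p.2) * blkD k W.1 = blkB k W.1 := by
    show blkB k W.1 * (blkD k W.1)⁻¹ * blkD k W.1 = _
    rw [Matrix.mul_assoc, Matrix.nonsing_inv_mul _ (isUnit_iff_ne_zero.2 hD), Matrix.mul_one]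
  have e : W.1 = glue p * N := by
    refine blk_ext (k := k) ?_ ?_ ?_ ?_
    · rw [blkA_mul, nA, nC, blkA_glue, Matrix.one_mul, Matrix.mul_zero, add_zero]
    · rw [blkB_mul, nB, nD, blkB_glue, Matrix.mul_zero, zero_add]; exact hS.symm
    · rw [blkC_mul, nA, nC, blkC_glue, Matrix.mul_zero, add_zero]; exact hT.symm
    · rw [blkD_mul, nB, nD, blkD_glue, Matrix.one_mul, Matrix.mul_zero, zero_add]
  have h1 : W.1.det ≠ 0 := ((Matrix.isUnit_iff_isUnit_det _).1 W.isUnit).ne_zero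
  have h2 : (glue p).det ≠ 0 := by
    rw [e, Matrix.det_mul] at h1
    exact left_ne_zero_of_mul h1
  refine ⟨h2, ?_⟩
  have e2 : ((toGL (glue p))⁻¹ * W).1 = N := by
    have h3 : W.1 = (toGL (glue p)).1 * N := by rw [toGL_val h2, ← e]
    rw [Units.val_mul, h3, ← Matrix.mul_assoc, Units.inv_mul, Matrix.one_mul]
  show IsBlockDiag k _
  rw [e2]
  exact hN

/-- The basic chart of `GL_n(ℝ) / (GL_k × GL_{n-k})`, around the class of the identity. Its inverse
sends `(T, S)` to the class of the matrix with blocks `1 S` over `T 1`. -/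
noncomputable def baseChartGL (n k : ℕ) : OpenPartialHomeomorph (GLQuot n k) (ModelGL n k) where
  toFun := coordGL n k
  invFun := fun p => QuotientGroup.mk (toGL (glue p))
  source := domGL n k
  target := {p | (glue p).det ≠ 0}
  map_source' := by
    intro x hx
    induction x using QuotientGroup.induction_on with
    | H W =>
    obtain ⟨hA, hD⟩ : (blkA k W.1).det ≠ 0 ∧ (blkD k W.1).det ≠ 0 := hx
    exact (exists_glue W hA hD).1
  map_target' := by
    intro p hp
    show (blkA k (toGL (glue p)).1).det ≠ 0 ∧ (blkD k (toGL (glue p)).1).det ≠ 0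
    rw [toGL_val hp, blkA_glue, blkD_glue]
    simp
  left_inv' := by
    intro x hx
    induction x using QuotientGroup.induction_on with
    | H W =>
    obtain ⟨hA, hD⟩ : (blkA k W.1).det ≠ 0 ∧ (blkD k W.1).det ≠ 0 := hx
    exact QuotientGroup.eq.2 (exists_glue W hA hD).2
  right_inv' := by
    intro p hp
    show (slopeLow k (toGL (glue p)).1, slopeHigh k (toGL (glue p)).1) = p
    rw [toGL_val hp, slopeLow, slopeHigh, blkA_glue, blkD_glue, blkB_glue, blkC_glue]
    simp only [inv_one]
    exact Prod.ext (Matrix.mul_one p.1) (Matrix.mul_one p.2)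
  open_source := by
    rw [← QuotientGroup.isOpenQuotientMap_mk.isQuotientMap.isOpen_preimage]
    exact ((continuous_blkA.comp Units.continuous_val).matrix_det.isOpen_preimage _
      isOpen_compl_singleton).inter ((continuous_blkD.comp Units.continuous_val).matrix_det.isOpen_preimage _
      isOpen_compl_singleton)
  open_target := continuous_glue.matrix_det.isOpen_preimage _ isOpen_compl_singleton
  continuousOn_toFun := by
    intro x hx
    refine ContinuousAt.continuousWithinAt ?_
    induction x using QuotientGroup.induction_on with
    | H W =>
    obtain ⟨hA, hD⟩ : (blkA k W.1).det ≠ 0 ∧ (blkD k W.1).det ≠ 0 := hx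
    rw [← QuotientGroup.isOpenQuotientMap_mk.continuousAt_comp_iff]
    exact (continuousAt_slope (continuous_blkC.comp Units.continuous_val)
      (continuous_blkA.comp Units.continuous_val) hA).prodMk
      (continuousAt_slope (continuous_blkB.comp Units.continuous_val)
      (continuous_blkD.comp Units.continuous_val) hD)
  continuousOn_invFun := by
    exact QuotientGroup.continuous_mk.comp_continuousOn
      (continuousOn_toGL.comp continuous_glue.continuousOn fun p hp => hp)

theorem inv_out_smul {G : Type} [Group G] {H : Subgroup G} (x : G ⧸ H) :
    (Quotient.out x)⁻¹ • x = (QuotientGroup.mk 1 : G ⧸ H) := by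
  rw [inv_smul_eq_iff]
  refine (QuotientGroup.out_eq' x).symm.trans ?_
  exact congrArg QuotientGroup.mk (mul_one (Quotient.out x)).symm

/-- The chart of `GL_n(ℝ) / (GL_k × GL_{n-k})` around `[W]`: the translate by `W` of the basic
chart. -/
noncomputable def chartGL {n k : ℕ} (W : GL (Fin n) ℝ) :
    OpenPartialHomeomorph (GLQuot n k) (ModelGL n k) :=
  (Homeomorph.smul W⁻¹).transOpenPartialHomeomorph (baseChartGL n k)

noncomputable instance chartedSpaceGLQuot (n k : ℕ) :
    ChartedSpace (ModelGL n k) (GLQuot n k) where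
  atlas := Set.range chartGL
  chartAt := fun x => chartGL (Quotient.out x)
  mem_chart_source := by
    intro x
    have h : (Quotient.out x)⁻¹ • x = (QuotientGroup.mk 1 : GLQuot n k) := inv_out_smul x
    show (Quotient.out x)⁻¹ • x ∈ domGL n k
    rw [h]
    show (blkA k 1).det ≠ 0 ∧ (blkD k 1).det ≠ 0
    simp only [blkA, blkD, Matrix.toBlock_one_self, Matrix.det_one]
    simp
  chart_mem_atlas := fun x => ⟨_, rfl⟩

instance isManifoldGLQuot (n k : ℕ) : IsManifold 𝓘(ℝ, ModelGL n k) ω (GLQuot n k) := by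
  refine isManifold_of_contDiffOn _ _ _ ?_
  rintro _ _ ⟨W, rfl⟩ ⟨W', rfl⟩
  have hsrc : ∀ p : ModelGL n k, p ∈ ((chartGL (k := k) W).symm ≫ₕ chartGL W').source →
      (glue p).det ≠ 0 ∧ (blkA k ((W'⁻¹ * W).1 * glue p)).det ≠ 0 ∧
        (blkD k ((W'⁻¹ * W).1 * glue p)).det ≠ 0 := by
    rintro p ⟨hp1, hp2⟩
    have h1 : (glue p).det ≠ 0 := hp1
    have h2 : (blkA k (W'⁻¹.1 * ((W⁻¹)⁻¹.1 * (toGL (glue p)).1))).det ≠ 0 ∧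
      (blkD k (W'⁻¹.1 * ((W⁻¹)⁻¹.1 * (toGL (glue p)).1))).det ≠ 0 := hp2
    rw [toGL_val h1, inv_inv, ← Matrix.mul_assoc, ← Units.val_mul] at h2
    exact ⟨h1, h2⟩
  have hfun : ∀ p : ModelGL n k, (glue p).det ≠ 0 →
      ((chartGL (k := k) W).symm ≫ₕ chartGL W') p =
        (slopeLow k ((W'⁻¹ * W).1 * glue p), slopeHigh k ((W'⁻¹ * W).1 * glue p)) := by
    intro p hp
    have h : ((chartGL (k := k) W).symm ≫ₕ chartGL W') p =
        (slopeLow k (W'⁻¹.1 * ((W⁻¹)⁻¹.1 * (toGL (glue p)).1)),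
          slopeHigh k (W'⁻¹.1 * ((W⁻¹)⁻¹.1 * (toGL (glue p)).1))) := rfl
    rw [h, toGL_val hp, inv_inv, ← Matrix.mul_assoc, ← Units.val_mul]
  have key : ContDiffOn ℝ ω ((chartGL (k := k) W).symm ≫ₕ chartGL W')
      ((chartGL (k := k) W).symm ≫ₕ chartGL W').source := by
    refine ContDiffOn.congr (f := fun p => (slopeLow k ((W'⁻¹ * W).1 * glue p),
      slopeHigh k ((W'⁻¹ * W).1 * glue p))) (fun p hp => ?_) fun p hp => hfun p (hsrc p hp).1
    have hX : ∀ i j, ContDiffAt ℝ ω (fun p : ModelGL n k => ((W'⁻¹ * W).1 * glue p) i j) p :=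
      fun i j => (contDiff_mul_glue _ i j).contDiffAt
    exact (ContDiffAt.prodMk (contDiffAt_slopeLow hX (hsrc p hp).2.1)
      (contDiffAt_slopeHigh hX (hsrc p hp).2.2)).contDiffWithinAt
  simpa using key

/-! #### Charts of `O_n / (O_k × O_{n-k})` -/

/-- The coordinates `[V] ↦ C A⁻¹`, where `V` has blocks `A B` over `C D`. -/
noncomputable def coordO (n k : ℕ) : OQuot n k → ModelO n k :=
  Quotient.lift (fun V => slopeLow k V.1) (by
    intro V V' h
    have h' : IsBlockDiag k (V⁻¹ * V').1 := QuotientGroup.leftRel_apply.1 h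
    have e : V'.1 = V.1 * (Unitary.toUnits (V⁻¹ * V')).1 := by
      rw [toUnits_val]; exact congrArg Subtype.val (mul_inv_cancel_left V V').symm
    show slopeLow k V.1 = slopeLow k V'.1
    rw [e, (low_mul _ _ (isBlockDiag_iff.1 h').1).1])

/-- The domain of `coordO`: the block `A` is invertible. -/
def domO (n k : ℕ) : Set (OQuot n k) :=
  {x | Quotient.lift (fun V : Matrix.orthogonalGroup (Fin n) ℝ => (blkA k V.1).det ≠ 0) (by
    intro V V' h
    have h' : IsBlockDiag k (V⁻¹ * V').1 := QuotientGroup.leftRel_apply.1 h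
    have e : V'.1 = V.1 * (Unitary.toUnits (V⁻¹ * V')).1 := by
      rw [toUnits_val]; exact congrArg Subtype.val (mul_inv_cancel_left V V').symm
    show ((blkA k V.1).det ≠ 0) = ((blkA k V'.1).det ≠ 0)
    rw [e, (low_mul _ _ (isBlockDiag_iff.1 h').1).2]) x}

theorem det_glue_zero {n k : ℕ} (T : ModelO n k) : (glue (T, 0)).det ≠ 0 := by
  have h : IsBlockUpper k (glue (T, 0))ᵀ :=
    isBlockUpper_transpose_iff_blkB.2 (blkB_glue (T, 0))
  have hA : blkA k (glue (T, 0))ᵀ = 1 :=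
    (congrArg Matrix.transpose (blkA_glue (T, 0))).trans Matrix.transpose_one
  have hD : blkD k (glue (T, 0))ᵀ = 1 :=
    (congrArg Matrix.transpose (blkD_glue (T, 0))).trans Matrix.transpose_one
  rw [← Matrix.det_transpose, det_of_isBlockUpper h, hA, hD]
  simp

theorem mk_gs_toUnits {n k : ℕ} (V : Matrix.orthogonalGroup (Fin n) ℝ) :
    (QuotientGroup.mk (gramSchmidtGL (Unitary.toUnits V)) : OQuot n k) = QuotientGroup.mk V := by
  rw [QuotientGroup.eq]
  apply orthogonal_isBlockDiag
  have h := isBlockUpper_gs k (Unitary.toUnits V)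
  rwa [← map_inv, ← map_mul, toUnits_val] at h

theorem gs_eq {n : ℕ} (W : GL (Fin n) ℝ) : (gramSchmidtGL W).1 =
    W.1 * (((Unitary.toUnits (gramSchmidtGL W))⁻¹ * W)⁻¹).1 := by
  rw [← Units.val_mul, mul_inv_rev, inv_inv, mul_inv_cancel_left, toUnits_val]

theorem continuous_gramSchmidtGL {n : ℕ} :
    Continuous (gramSchmidtGL : GL (Fin n) ℝ → Matrix.orthogonalGroup (Fin n) ℝ) := by
  have hcol : ∀ j : Fin n, Continuous fun W : GL (Fin n) ℝ => colVec W.1 j := fun j =>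
    (PiLp.continuous_toLp 2 _).comp
      (continuous_pi fun i => Units.continuous_val.matrix_elem i j)
  have hgs : ∀ j : Fin n, Continuous fun W : GL (Fin n) ℝ =>
      InnerProductSpace.gramSchmidt ℝ (colVec W.1) j := by
    intro j
    induction j using WellFoundedLT.induction with
    | ind j ih =>
    have e : (fun W : GL (Fin n) ℝ => InnerProductSpace.gramSchmidt ℝ (colVec W.1) j) = fun W =>
        colVec W.1 j - ∑ i ∈ Finset.Iio j,
          (ℝ ∙ InnerProductSpace.gramSchmidt ℝ (colVec W.1) i).starProjection (colVec W.1 j) :=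
      funext fun W => InnerProductSpace.gramSchmidt_def ℝ _ j
    rw [e]
    simp only [Submodule.starProjection_singleton]
    refine (hcol j).sub (continuous_finsetSum _ fun i hi => ?_)
    have hi' := ih i (Finset.mem_Iio.1 hi)
    refine (((Continuous.inner (𝕜 := ℝ) hi' (hcol j)).div ?_) ?_).smul hi'
    · exact RCLike.continuous_ofReal.comp (hi'.norm.pow 2)
    · intro W
      have := InnerProductSpace.gramSchmidt_ne_zero i (linearIndependent_colVec W)
      simpa using this
  refine Continuous.subtype_mk (continuous_matrix fun i j => ?_) _
  have h : Continuous fun W : GL (Fin n) ℝ =>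
      InnerProductSpace.gramSchmidtNormed ℝ (colVec W.1) j := by
    simp only [InnerProductSpace.gramSchmidtNormed]
    refine Continuous.fun_smul (Continuous.inv₀ (f := fun W : GL (Fin n) ℝ =>
      (RCLike.ofReal ‖InnerProductSpace.gramSchmidt ℝ (colVec W.1) j‖ : ℝ)) ?_ ?_) (hgs j)
    · exact RCLike.continuous_ofReal.comp (hgs j).norm
    · intro W
      have := InnerProductSpace.gramSchmidt_ne_zero j (linearIndependent_colVec W)
      simpa using this
  exact (EuclideanSpace.proj (𝕜 := ℝ) i).continuous.comp h

/-- The basic chart of `O_n / (O_k × O_{n-k})`, around the class of the identity. Its inverse sends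
`T` to the class of the Gram-Schmidt matrix of the matrix with blocks `1 0` over `T 1`. -/
noncomputable def baseChartO (n k : ℕ) : OpenPartialHomeomorph (OQuot n k) (ModelO n k) where
  toFun := coordO n k
  invFun := fun T => QuotientGroup.mk (gramSchmidtGL (toGL (glue (T, 0))))
  source := domO n k
  target := Set.univ
  map_source' := fun _ _ => Set.mem_univ _
  map_target' := by
    intro T _
    show (blkA k (gramSchmidtGL (toGL (glue (T, 0)))).1).det ≠ 0
    rw [gs_eq, (low_mul _ _ (IsBlockUpper.inv _ (isBlockUpper_gs k _))).2,
      toGL_val (det_glue_zero T), blkA_glue]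
    simp
  left_inv' := by
    intro x hx
    induction x using QuotientGroup.induction_on with
    | H V =>
    have hA : (blkA k V.1).det ≠ 0 := hx
    rw [← mk_gs_toUnits V]
    apply gs_wellDefined
    rw [mk_gs_toUnits V]
    show IsBlockUpper k ((toGL (glue (slopeLow k V.1, 0)))⁻¹ * Unitary.toUnits V).1
    set g := toGL (glue (slopeLow k V.1, 0)) with hg
    set N := g⁻¹ * Unitary.toUnits V with hN
    have e : V.1 = glue (slopeLow k V.1, 0) * N.1 := by
      rw [← toGL_val (det_glue_zero (slopeLow k V.1)), ← hg, ← Units.val_mul, hN,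
        mul_inv_cancel_left, toUnits_val]
    have eA : blkA k V.1 = blkA k N.1 := by
      conv_lhs => rw [e]
      rw [blkA_mul, blkA_glue, blkB_glue]
      exact (congrArg₂ _ (Matrix.one_mul _) (Matrix.zero_mul _)).trans (add_zero _)
    have eC : blkC k V.1 = blkC k V.1 * (blkA k V.1)⁻¹ * blkA k N.1 + blkC k N.1 := by
      conv_lhs => rw [e]
      rw [blkC_mul, blkC_glue, blkD_glue, Matrix.one_mul]
      rfl
    rw [← eA, Matrix.mul_assoc, Matrix.nonsing_inv_mul _ (isUnit_iff_ne_zero.2 hA),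
      Matrix.mul_one] at eC
    exact isBlockUpper_iff_blkC.2 (left_eq_add.1 eC)
  right_inv' := by
    intro T _
    show slopeLow k (gramSchmidtGL (toGL (glue (T, 0)))).1 = T
    rw [gs_eq, (low_mul _ _ (IsBlockUpper.inv _ (isBlockUpper_gs k _))).1,
      toGL_val (det_glue_zero T), slopeLow, blkA_glue, blkC_glue, inv_one]
    exact Matrix.mul_one _
  open_source := by
    rw [← QuotientGroup.isOpenQuotientMap_mk.isQuotientMap.isOpen_preimage]
    exact (continuous_blkA.comp continuous_subtype_val).matrix_det.isOpen_preimage _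
      isOpen_compl_singleton
  open_target := isOpen_univ
  continuousOn_toFun := by
    intro x hx
    refine ContinuousAt.continuousWithinAt ?_
    induction x using QuotientGroup.induction_on with
    | H V =>
    have hA : (blkA k V.1).det ≠ 0 := hx
    rw [← QuotientGroup.isOpenQuotientMap_mk.continuousAt_comp_iff]
    exact continuousAt_slope (continuous_blkC.comp continuous_subtype_val)
      (continuous_blkA.comp continuous_subtype_val) hA
  continuousOn_invFun := by
    refine (QuotientGroup.continuous_mk.comp continuous_gramSchmidtGL).comp_continuousOn ?_
    refine continuousOn_toGL.comp (t := {M : Matrix (Fin n) (Fin n) ℝ | M.det ≠ 0}) ?_ fun T _ => det_glue_zero T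
    exact (continuous_glue.comp (Continuous.prodMk_left 0)).continuousOn

/-- The chart of `O_n / (O_k × O_{n-k})` around `[V]`: the translate by `V` of the basic chart. -/
noncomputable def chartO {n k : ℕ} (V : Matrix.orthogonalGroup (Fin n) ℝ) :
    OpenPartialHomeomorph (OQuot n k) (ModelO n k) :=
  (Homeomorph.smul V⁻¹).transOpenPartialHomeomorph (baseChartO n k)

noncomputable instance chartedSpaceOQuot (n k : ℕ) :
    ChartedSpace (ModelO n k) (OQuot n k) where
  atlas := Set.range chartO
  chartAt := fun x => chartO (Quotient.out x)
  mem_chart_source := by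
    intro x
    have h : (Quotient.out x)⁻¹ • x = (QuotientGroup.mk 1 : OQuot n k) := inv_out_smul x
    show (Quotient.out x)⁻¹ • x ∈ domO n k
    rw [h]
    show (blkA k 1).det ≠ 0
    simp only [blkA, Matrix.toBlock_one_self, Matrix.det_one]
    simp
  chart_mem_atlas := fun x => ⟨_, rfl⟩

instance isManifoldOQuot (n k : ℕ) : IsManifold 𝓘(ℝ, ModelO n k) ω (OQuot n k) := by
  refine isManifold_of_contDiffOn _ _ _ ?_
  rintro _ _ ⟨V, rfl⟩ ⟨V', rfl⟩
  have hval : ∀ T : ModelO n k, ∃ g : GL (Fin n) ℝ, IsBlockUpper k g.1 ∧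
      (V'⁻¹ * ((V⁻¹)⁻¹ * gramSchmidtGL (toGL (glue (T, 0))))).1 =
        (V'⁻¹ * V).1 * glue (T, 0) * g.1 := by
    intro T
    refine ⟨_, IsBlockUpper.inv _ (isBlockUpper_gs k (toGL (glue (T, 0)))), ?_⟩
    rw [inv_inv, ← mul_assoc]
    show (V'⁻¹ * V).1 * (gramSchmidtGL (toGL (glue (T, 0)))).1 = _
    rw [gs_eq, toGL_val (det_glue_zero T), Matrix.mul_assoc]
  have hsrc : ∀ T : ModelO n k, T ∈ ((chartO (k := k) V).symm ≫ₕ chartO V').source →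
      (blkA k ((V'⁻¹ * V).1 * glue (T, 0))).det ≠ 0 := by
    rintro T ⟨-, hT⟩
    have h : (blkA k (V'⁻¹ * ((V⁻¹)⁻¹ * gramSchmidtGL (toGL (glue (T, 0))))).1).det ≠ 0 := hT
    obtain ⟨g, hg, e⟩ := hval T
    rwa [e, (low_mul _ g hg).2] at h
  have hfun : ∀ T : ModelO n k, ((chartO (k := k) V).symm ≫ₕ chartO V') T =
      slopeLow k ((V'⁻¹ * V).1 * glue (T, 0)) := by
    intro T
    have h : ((chartO (k := k) V).symm ≫ₕ chartO V') T =
        slopeLow k (V'⁻¹ * ((V⁻¹)⁻¹ * gramSchmidtGL (toGL (glue (T, 0))))).1 := rfl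
    obtain ⟨g, hg, e⟩ := hval T
    rw [h, e, (low_mul _ g hg).1]
  have key : ContDiffOn ℝ ω ((chartO (k := k) V).symm ≫ₕ chartO V')
      ((chartO (k := k) V).symm ≫ₕ chartO V').source := by
    refine ContDiffOn.congr (f := fun T => slopeLow k ((V'⁻¹ * V).1 * glue (T, 0)))
      (fun T hT => ?_) fun T _ => hfun T
    have hX : ∀ i j, ContDiffAt ℝ ω
        (fun T : ModelO n k => ((V'⁻¹ * V).1 * glue (T, 0)) i j) T := fun i j =>
      ((contDiff_mul_glue _ i j).comp (contDiff_id.prodMk contDiff_const)).contDiffAt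
    exact (contDiffAt_slopeLow hX (hsrc T hT)).contDiffWithinAt
  simpa using key

end GramSchmidtBundle

namespace GramSchmidtBundle

/-! ### Analytic quotient maps and analytic vector bundles -/

/-- `π : S → X`, defined on an analytic submanifold `j : S → ℝ^{n×n}` of the space of matrices, is an
analytic submersion: locally it is the restriction of an analytic map on an open set of matrices,
and through every point of `S` there passes an analytic local section of `π`. For a surjective `π`
this determines the analytic structure of `X`. -/
def IsAnalyticSubmersion {n : ℕ} {S X E : Type} [TopologicalSpace S] [TopologicalSpace X]
    [NormedAddCommGroup E] [NormedSpace ℝ E] [ChartedSpace E X]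
    (j : S → Fin n → Fin n → ℝ) (π : S → X) : Prop :=
  ∀ s : S,
    (∃ f : (Fin n → Fin n → ℝ) → X,
      ContMDiffAt 𝓘(ℝ, Fin n → Fin n → ℝ) 𝓘(ℝ, E) ω f (j s) ∧ ∀ᶠ t in 𝓝 s, f (j t) = π t) ∧
    ∃ τ : X → S, τ (π s) = s ∧
      ContMDiffAt 𝓘(ℝ, E) 𝓘(ℝ, Fin n → Fin n → ℝ) ω (fun y => j (τ y)) (π s) ∧
      ∀ᶠ y in 𝓝 (π s), π (τ y) = y

/-- The surjection `proj : Z → B` between analytic manifolds, with the given vector space structures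
on its fibres, is a locally trivial real analytic vector bundle with model fibre `F`: there are
fibrewise linear, bi-analytic local trivialisations around all points of `B`, whose transition
functions are analytic as maps into the continuous linear operators of `F`. -/
structure IsAnalyticVectorBundle (F : Type) [NormedAddCommGroup F] [NormedSpace ℝ F]
    {EB HB B EZ HZ Z : Type} [NormedAddCommGroup EB] [NormedSpace ℝ EB] [TopologicalSpace HB]
    (IB : ModelWithCorners ℝ EB HB) [TopologicalSpace B] [ChartedSpace HB B]
    [NormedAddCommGroup EZ] [NormedSpace ℝ EZ] [TopologicalSpace HZ]
    (IZ : ModelWithCorners ℝ EZ HZ) [TopologicalSpace Z] [ChartedSpace HZ Z]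
    (proj : Z → B) [∀ b : B, AddCommGroup (proj ⁻¹' {b})] [∀ b : B, Module ℝ (proj ⁻¹' {b})] :
    Prop where
  isManifold_base : IsManifold IB ω B
  isManifold_total : IsManifold IZ ω Z
  t2_base : T2Space B
  t2_total : T2Space Z
  surjective : Function.Surjective proj
  analytic_proj : ContMDiff IZ IB ω proj
  exists_trivializations : ∃ e : B → Bundle.Trivialization F proj,
    (∀ b : B, b ∈ (e b).baseSet ∧
      ContMDiffOn IZ (IB.prod 𝓘(ℝ, F)) ω (e b) (e b).source ∧
      ContMDiffOn (IB.prod 𝓘(ℝ, F)) IZ ω (e b).toOpenPartialHomeomorph.symm (e b).target ∧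
      ∀ x ∈ (e b).baseSet, IsLinearMap ℝ fun z : proj ⁻¹' {x} => (e b z.1).2) ∧
    ∀ b b' : B, ∃ φ : B → F →L[ℝ] F,
      ContMDiffOn IB 𝓘(ℝ, F →L[ℝ] F) ω φ ((e b).baseSet ∩ (e b').baseSet) ∧
      ∀ x ∈ (e b).baseSet ∩ (e b').baseSet, ∀ v : F, φ x v = (e b).coordChange (e b') x v

end GramSchmidtBundle

open GramSchmidtBundle

/-!
Write `e = V P_k Vᵀ` for the orthogonal projection attached to `x = [V]` and `q = W P_k W⁻¹` for
the idempotent attached to `y = [W]`. Gram-Schmidt preserves the spans of the first columns, so `y`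
lies over `x` exactly when `e` and `q` have the same range, that is `e q = q` and `q e = e`. For
given `e` the solutions are the `e + a` with `e a = a` and `a e = 0`. If `q` is close to `e`, the
element `q e + (1 - q) (1 - e)` is invertible and conjugates `e` into `q`; this gives analytic local
inverses of `y ↦ q`, hence also of `x ↦ e`.

Differentiating `e² = e` along a tangent vector `v` gives `e ė + ė e = ė`, so `a = e ė` is a
direction of the fibre over `x`, and `ė = a + aᵀ` because `e` is symmetric. The bijection `Φ` is
`v ↦ e + e ė`. Its inverse sends `y` to the image of the tangent vector `a + aᵀ` at `e`, where
`a = q - e`, under the derivative of the local inverse of `x ↦ e`, so it is analytic. The bundle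
structure is then that of the tangent bundle.
-/

namespace GramSchmidtBundle

/-! ### Idempotents and the fibres of the Gram-Schmidt map -/

section IdempotentElements

variable {A : Type*} [Ring A]

/-- For an idempotent `e`, the direction of the affine space of the idempotents with the same range
as `e`: the elements that map into the range of `e` and vanish on it. -/
def idemDirection (R : Type*) [CommSemiring R] [Algebra R A] (e : A) : Submodule R A where
  carrier := {a | e * a = a ∧ a * e = 0}
  add_mem' := fun ha hb =>
    ⟨by rw [mul_add, ha.1, hb.1], by rw [add_mul, ha.2, hb.2, add_zero]⟩
  zero_mem' := ⟨mul_zero e, zero_mul e⟩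
  smul_mem' := fun c a ha => ⟨by rw [mul_smul_comm, ha.1], by rw [smul_mul_assoc, ha.2, smul_zero]⟩

/-- An element conjugating the idempotent `e` to the idempotent `q` as soon as it is a unit, which
is the case for `q` close to `e`. -/
def intertwiner (q e : A) : A :=
  q * e + (1 - q) * (1 - e)

variable {e q a : A}

theorem sub_mem_idemDirection_iff {R : Type*} [CommSemiring R] [Algebra R A]
    (he : IsIdempotentElem e) : q - e ∈ idemDirection R e ↔ e * q = q ∧ q * e = e := by
  change e * (q - e) = q - e ∧ (q - e) * e = 0 ↔ _
  rw [mul_sub, sub_mul, he.eq, sub_left_inj, sub_eq_zero]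

theorem mul_self_eq_zero_of_mem_idemDirection {R : Type*} [CommSemiring R] [Algebra R A]
    (ha : a ∈ idemDirection R e) : a * a = 0 :=
  calc a * a = a * e * a := by rw [mul_assoc, ha.1]
    _ = 0 := by rw [ha.2, zero_mul]

theorem isIdempotentElem_add_of_mem_idemDirection {R : Type*} [CommSemiring R] [Algebra R A]
    (he : IsIdempotentElem e) (ha : a ∈ idemDirection R e) : IsIdempotentElem (e + a) := by
  change (e + a) * (e + a) = e + a
  linear_combination (norm := noncomm_ring)
    he.eq + ha.1 + ha.2 + mul_self_eq_zero_of_mem_idemDirection ha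

theorem intertwiner_self (he : IsIdempotentElem e) : intertwiner e e = 1 := by
  rw [intertwiner, he.eq, he.one_sub.eq, add_sub_cancel]

theorem mul_intertwiner (hq : IsIdempotentElem q) (he : IsIdempotentElem e) :
    q * intertwiner q e = intertwiner q e * e := by
  rw [intertwiner, mul_add, add_mul, ← mul_assoc, ← mul_assoc, hq.eq, hq.mul_one_sub_self,
    mul_assoc, mul_assoc, he.eq, he.one_sub_mul_self, zero_mul, mul_zero]

theorem intertwiner_add_of_mem_idemDirection {R : Type*} [CommSemiring R] [Algebra R A]
    (he : IsIdempotentElem e) (ha : a ∈ idemDirection R e) : intertwiner (e + a) e = 1 - a := by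
  rw [intertwiner]
  linear_combination (norm := noncomm_ring) 2 * he.eq + 2 * ha.2

theorem isUnit_one_sub_of_mem_idemDirection {R : Type*} [CommSemiring R] [Algebra R A]
    (ha : a ∈ idemDirection R e) : IsUnit (1 - a) :=
  IsNilpotent.isUnit_one_sub ⟨2, by rw [sq, mul_self_eq_zero_of_mem_idemDirection ha]⟩

theorem mul_mem_idemDirection_of_mul_add_mul_eq {R : Type*} [CommSemiring R] [Algebra R A]
    (he : IsIdempotentElem e) (h : e * a + a * e = a) : e * a ∈ idemDirection R e := by
  refine ⟨by rw [← mul_assoc, he.eq], ?_⟩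
  have hmul : e * (e * a + a * e) = e * a := by rw [h]
  rwa [mul_add, ← mul_assoc, ← mul_assoc, he.eq, add_eq_left] at hmul

end IdempotentElements

section Grassmannian

variable {n k : ℕ}

theorem isBlockUpper_iff_diagProj {M : Matrix (Fin n) (Fin n) ℝ} :
    IsBlockUpper k M ↔ diagProj n k * (M * diagProj n k) = M * diagProj n k := by
  simp only [diagProj, ← Matrix.ext_iff, Matrix.diagonal_mul, Matrix.mul_diagonal, IsBlockUpper]
  refine forall₂_congr fun i j => ?_
  by_cases hi : i.1 < k <;> by_cases hj : j.1 < k <;> simp [hi, hj, eq_comm]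

theorem isIdempotentElem_diagProj : IsIdempotentElem (diagProj n k) := by
  simp only [IsIdempotentElem, diagProj, Matrix.diagonal_mul_diagonal]
  congr 1
  ext i
  split_ifs <;> simp

theorem isIdempotentElem_idem (y : GLQuot n k) : IsIdempotentElem (idem n k y) := by
  induction y using QuotientGroup.induction_on with
  | H W =>
    calc W.1 * diagProj n k * W⁻¹.1 * (W.1 * diagProj n k * W⁻¹.1)
      _ = W.1 * (diagProj n k * (W⁻¹.1 * W.1) * diagProj n k) * W⁻¹.1 := by
        simp only [Matrix.mul_assoc]
      _ = W.1 * diagProj n k * W⁻¹.1 := by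
        rw [Units.inv_mul, Matrix.mul_one, isIdempotentElem_diagProj.eq]

theorem idem_mul_idem_mk_eq_iff (W W' : GL (Fin n) ℝ) :
    idem n k W * idem n k W' = idem n k W' ↔ IsBlockUpper k (W⁻¹ * W').1 := by
  have hl : idem n k W * idem n k W' =
      W.1 * (diagProj n k * ((W⁻¹ * W').1 * diagProj n k)) * W'⁻¹.1 := by
    rw [Units.val_mul]
    change W.1 * diagProj n k * W⁻¹.1 * (W'.1 * diagProj n k * W'⁻¹.1) = _
    simp only [Matrix.mul_assoc]
  have hr : idem n k W' = W.1 * ((W⁻¹ * W').1 * diagProj n k) * W'⁻¹.1 := by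
    rw [← Matrix.mul_assoc, ← Units.val_mul, mul_inv_cancel_left]
    rfl
  rw [isBlockUpper_iff_diagProj, hl, hr, Units.mul_left_inj, Units.mul_right_inj]

theorem gramSchmidtMap_eq_iff (y y' : GLQuot n k) :
    gramSchmidtMap n k y = gramSchmidtMap n k y' ↔ idem n k y * idem n k y' = idem n k y' := by
  induction y using QuotientGroup.induction_on with
  | H W =>
  induction y' using QuotientGroup.induction_on with
  | H W' =>
  rw [idem_mul_idem_mk_eq_iff]
  refine ⟨fun h => ?_, gs_wellDefined W W'⟩
  have hV : IsBlockUpper k (Unitary.toUnits ((gramSchmidtGL W)⁻¹ * gramSchmidtGL W')).1 :=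
    (isBlockDiag_iff.1 (QuotientGroup.eq.1 h)).1
  have e : W⁻¹ * W' = ((Unitary.toUnits (gramSchmidtGL W))⁻¹ * W)⁻¹ *
      Unitary.toUnits ((gramSchmidtGL W)⁻¹ * gramSchmidtGL W') *
        ((Unitary.toUnits (gramSchmidtGL W'))⁻¹ * W') := by
    rw [map_mul, map_inv]
    group
  rw [e]
  exact ((IsBlockUpper.inv _ (isBlockUpper_gs k W)).mul hV).mul (isBlockUpper_gs k W')

theorem isBlockDiag_iff_commute_diagProj {M : Matrix (Fin n) (Fin n) ℝ} :
    IsBlockDiag k M ↔ Commute M (diagProj n k) := by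
  refine ⟨diagProj_comm, fun h i j hij => ?_⟩
  have hM := congrFun (congrFun h.eq i) j
  rw [diagProj, Matrix.mul_diagonal, Matrix.diagonal_mul] at hM
  by_cases hi : i.1 < k <;> by_cases hj : j.1 < k <;> simp_all

theorem idem_injective : Function.Injective (idem n k) := by
  intro y y' h
  induction y using QuotientGroup.induction_on with
  | H W =>
  induction y' using QuotientGroup.induction_on with
  | H W' =>
  refine QuotientGroup.eq.2 (isBlockDiag_iff_commute_diagProj.2 ?_)
  have h' : W.1 * diagProj n k * W⁻¹.1 = W'.1 * diagProj n k * W'⁻¹.1 := h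
  calc (W⁻¹ * W').1 * diagProj n k
    _ = W⁻¹.1 * (W'.1 * diagProj n k * W'⁻¹.1) * W'.1 := by simp [Matrix.mul_assoc]
    _ = diagProj n k * (W⁻¹ * W').1 := by
      rw [← h']
      simp [Matrix.mul_assoc]

theorem idem_smul (g : GL (Fin n) ℝ) (y : GLQuot n k) :
    idem n k (g • y) = g.1 * idem n k y * g⁻¹.1 := by
  induction y using QuotientGroup.induction_on with
  | H W =>
    change (g * W).1 * diagProj n k * (g * W)⁻¹.1 = g.1 * (W.1 * diagProj n k * W⁻¹.1) * g⁻¹.1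
    rw [mul_inv_rev, Units.val_mul, Units.val_mul]
    simp only [Matrix.mul_assoc]

/-- A local inverse of `idem` around `idem n k y`, defined on all matrices. -/
noncomputable def idemLocalInverse (y : GLQuot n k) (A : Matrix (Fin n) (Fin n) ℝ) : GLQuot n k :=
  toGL (intertwiner A (idem n k y)) • y

theorem idem_idemLocalInverse {y : GLQuot n k} {A : Matrix (Fin n) (Fin n) ℝ}
    (hA : IsIdempotentElem A) (h : (intertwiner A (idem n k y)).det ≠ 0) :
    idem n k (idemLocalInverse y A) = A := by
  rw [idemLocalInverse, idem_smul, toGL_val h, ← mul_intertwiner hA (isIdempotentElem_idem y),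
    Matrix.mul_assoc]
  nth_rw 1 [← toGL_val h]
  rw [Units.mul_inv, Matrix.mul_one]

theorem idemLocalInverse_idem {y y' : GLQuot n k}
    (h : (intertwiner (idem n k y') (idem n k y)).det ≠ 0) :
    idemLocalInverse y (idem n k y') = y' :=
  idem_injective (idem_idemLocalInverse (isIdempotentElem_idem y') h)

/-- The inclusion `[V] ↦ [V]` of `O_n / (O_k × O_{n-k})` into `GL_n(ℝ) / (GL_k × GL_{n-k})`, the
zero section of the bundle. -/
def inclusion (n k : ℕ) : OQuot n k → GLQuot n k :=
  Quotient.map' Unitary.toUnits fun V V' h => by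
    rw [QuotientGroup.leftRel_apply] at h ⊢
    rw [← map_inv, ← map_mul]
    exact h

theorem orthProj_eq_idem_inclusion : orthProj n k = idem n k ∘ inclusion n k := by
  ext1 x
  induction x using QuotientGroup.induction_on with
  | H V => rfl

theorem gramSchmidtMap_inclusion (x : OQuot n k) : gramSchmidtMap n k (inclusion n k x) = x := by
  induction x using QuotientGroup.induction_on with
  | H V => exact mk_gs_toUnits V

theorem isIdempotentElem_orthProj (x : OQuot n k) : IsIdempotentElem (orthProj n k x) := by
  rw [orthProj_eq_idem_inclusion]
  exact isIdempotentElem_idem _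

theorem orthProj_transpose (x : OQuot n k) : (orthProj n k x)ᵀ = orthProj n k x := by
  induction x using QuotientGroup.induction_on with
  | H V =>
    change (V.1 * diagProj n k * V.1ᵀ)ᵀ = V.1 * diagProj n k * V.1ᵀ
    rw [Matrix.transpose_mul, Matrix.transpose_mul, Matrix.transpose_transpose, diagProj,
      Matrix.diagonal_transpose, Matrix.mul_assoc]

theorem gramSchmidtMap_eq_iff_mul_orthProj {x : OQuot n k} {y : GLQuot n k} :
    gramSchmidtMap n k y = x ↔
      orthProj n k x * idem n k y = idem n k y ∧ idem n k y * orthProj n k x = orthProj n k x := by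
  rw [orthProj_eq_idem_inclusion, Function.comp_apply, ← gramSchmidtMap_eq_iff,
    ← gramSchmidtMap_eq_iff, gramSchmidtMap_inclusion, eq_comm, and_self]

theorem idem_sub_orthProj_mem_iff {x : OQuot n k} {y : GLQuot n k} :
    idem n k y - orthProj n k x ∈ idemDirection ℝ (orthProj n k x) ↔ gramSchmidtMap n k y = x := by
  rw [sub_mem_idemDirection_iff (isIdempotentElem_orthProj x), gramSchmidtMap_eq_iff_mul_orthProj]

theorem exists_idem_eq_orthProj_add (x : OQuot n k) {a : Matrix (Fin n) (Fin n) ℝ}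
    (ha : a ∈ idemDirection ℝ (orthProj n k x)) :
    ∃ y, idem n k y = orthProj n k x + a := by
  have he := isIdempotentElem_orthProj x
  have hq := isIdempotentElem_add_of_mem_idemDirection he ha
  refine ⟨idemLocalInverse (inclusion n k x) (orthProj n k x + a), idem_idemLocalInverse hq ?_⟩
  change (intertwiner _ ((idem n k ∘ inclusion n k) x)).det ≠ 0
  rw [← orthProj_eq_idem_inclusion, intertwiner_add_of_mem_idemDirection he ha]
  exact ((Matrix.isUnit_iff_isUnit_det _).1 (isUnit_one_sub_of_mem_idemDirection ha)).ne_zero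

theorem mul_eq_right_iff_range_le {m : Type*} [Fintype m] {R : Type*} [CommRing R]
    {e q : Matrix m m R} (he : IsIdempotentElem e) :
    e * q = q ↔ LinearMap.range q.mulVecLin ≤ LinearMap.range e.mulVecLin := by
  classical
  have he' : IsIdempotentElem e.mulVecLin := by
    rw [IsIdempotentElem, Module.End.mul_eq_comp, ← Matrix.mulVecLin_mul, he.eq]
  rw [← LinearMap.IsIdempotentElem.comp_eq_right_iff he', ← Matrix.mulVecLin_mul]
  exact (Matrix.toLin'.injective.eq_iff (a := e * q)).symm

theorem idem_image_fibre (x : OQuot n k) :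
    idem n k '' (gramSchmidtMap n k ⁻¹' {x}) =
      {Q | Q * Q = Q ∧
        LinearMap.range Q.mulVecLin = LinearMap.range (orthProj n k x).mulVecLin} := by
  have he := isIdempotentElem_orthProj x
  ext Q
  constructor
  · rintro ⟨y, hy, rfl⟩
    obtain ⟨h, h'⟩ := gramSchmidtMap_eq_iff_mul_orthProj.1 hy
    have hQ := isIdempotentElem_idem y
    exact ⟨hQ, le_antisymm ((mul_eq_right_iff_range_le he).1 h)
      ((mul_eq_right_iff_range_le hQ).1 h')⟩
  · rintro ⟨hQ, hr⟩
    have hmem : Q - orthProj n k x ∈ idemDirection ℝ (orthProj n k x) :=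
      (sub_mem_idemDirection_iff he).2
        ⟨(mul_eq_right_iff_range_le he).2 hr.le, (mul_eq_right_iff_range_le hQ).2 hr.ge⟩
    obtain ⟨y, hy⟩ := exists_idem_eq_orthProj_add x hmem
    rw [add_sub_cancel] at hy
    exact ⟨y, idem_sub_orthProj_mem_iff.1 (hy ▸ hmem), hy⟩

/-- The identification of the fibre of `gramSchmidtMap` over `x` with the direction of an affine
space of idempotents, with `orthProj n k x` as origin. -/
noncomputable def fibreEquiv (x : OQuot n k) :
    (gramSchmidtMap n k ⁻¹' {x}) ≃ idemDirection ℝ (orthProj n k x) :=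
  .ofBijective (fun y => ⟨idem n k y.1 - orthProj n k x, idem_sub_orthProj_mem_iff.2 y.2⟩) <| by
    refine ⟨fun y y' h =>
      Subtype.ext (idem_injective (sub_left_injective (congrArg Subtype.val h))), fun a => ?_⟩
    obtain ⟨y, hy⟩ := exists_idem_eq_orthProj_add x a.2
    have ha : idem n k y - orthProj n k x = a := by rw [hy, add_sub_cancel_left]
    exact ⟨⟨y, idem_sub_orthProj_mem_iff.1 (ha ▸ a.2)⟩, Subtype.ext ha⟩

noncomputable instance fibreAddCommGroup (x : OQuot n k) :
    AddCommGroup (gramSchmidtMap n k ⁻¹' {x}) :=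
  (fibreEquiv x).addCommGroup

noncomputable instance fibreModule (x : OQuot n k) : Module ℝ (gramSchmidtMap n k ⁻¹' {x}) :=
  (fibreEquiv x).module ℝ

/-- `fibreEquiv` as a linear equivalence, for the vector space structure it transports to the
fibre. -/
noncomputable def fibreLinearEquiv (x : OQuot n k) :
    (gramSchmidtMap n k ⁻¹' {x}) ≃ₗ[ℝ] idemDirection ℝ (orthProj n k x) :=
  (fibreEquiv x).linearEquiv ℝ

theorem isLinearMap_idem_sub_orthProj (x : OQuot n k) :
    IsLinearMap ℝ fun y : gramSchmidtMap n k ⁻¹' {x} => idem n k y.1 - orthProj n k x :=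
  ((idemDirection ℝ (orthProj n k x)).subtype ∘ₗ (fibreLinearEquiv x).toLinearMap).isLinear

end Grassmannian

/-! ### Vector bundles and tangent maps -/

section VectorBundleTransport

open Bundle

theorem isLinearMap_trivialization_symm {R F B Z : Type*} [Semiring R] [AddCommMonoid F]
    [Module R F] [TopologicalSpace F] [TopologicalSpace B] {V : B → Type*}
    [TopologicalSpace (TotalSpace F V)] [∀ b, AddCommMonoid (V b)] [∀ b, Module R (V b)]
    {proj : Z → B} [∀ b, AddCommMonoid (proj ⁻¹' {b})] [∀ b, Module R (proj ⁻¹' {b})]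
    (Φ : TotalSpace F V ≃ Z) (hΦ : ∀ p, proj (Φ p) = p.proj)
    (hlin : ∀ b, IsLinearMap R fun v : V b => (⟨Φ ⟨b, v⟩, hΦ ⟨b, v⟩⟩ : proj ⁻¹' {b}))
    (e : Trivialization F (TotalSpace.proj : TotalSpace F V → B)) [e.IsLinear R] {b : B}
    (hb : b ∈ e.baseSet) : IsLinearMap R fun z : proj ⁻¹' {b} => (e (Φ.symm z)).2 := by
  let L : V b →ₗ[R] proj ⁻¹' {b} := IsLinearMap.mk' _ (hlin b)
  have hsurj : ∀ z : proj ⁻¹' {b}, ∃ v, L v = z := by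
    rintro ⟨z, hz⟩
    obtain ⟨⟨b', v⟩, rfl⟩ := Φ.surjective z
    obtain rfl : b' = b := (hΦ ⟨b', v⟩).symm.trans hz
    exact ⟨v, rfl⟩
  have happ (v : V b) : (e (Φ.symm (L v))).2 = (e ⟨b, v⟩).2 :=
    congrArg (fun p => (e p).2) (Φ.symm_apply_apply ⟨b, v⟩)
  constructor
  · intro z z'
    obtain ⟨v, rfl⟩ := hsurj z
    obtain ⟨v', rfl⟩ := hsurj z'
    rw [← map_add, happ, happ, happ, (e.linear R hb).map_add]
  · intro c z
    obtain ⟨v, rfl⟩ := hsurj z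
    rw [← map_smul, happ, happ, (e.linear R hb).map_smul]

theorem isAnalyticVectorBundle_of_diffeomorph {F EB HB B EZ HZ Z : Type} [NormedAddCommGroup F]
    [NormedSpace ℝ F] [NormedAddCommGroup EB] [NormedSpace ℝ EB] [TopologicalSpace HB]
    {IB : ModelWithCorners ℝ EB HB} [TopologicalSpace B] [ChartedSpace HB B]
    [NormedAddCommGroup EZ] [NormedSpace ℝ EZ] [TopologicalSpace HZ]
    {IZ : ModelWithCorners ℝ EZ HZ} [TopologicalSpace Z] [ChartedSpace HZ Z] {V : B → Type}
    [TopologicalSpace (TotalSpace F V)] [∀ b, TopologicalSpace (V b)] [∀ b, AddCommGroup (V b)]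
    [∀ b, Module ℝ (V b)] [FiberBundle F V] [VectorBundle ℝ F V] {proj : Z → B}
    [∀ b, AddCommGroup (proj ⁻¹' {b})] [∀ b, Module ℝ (proj ⁻¹' {b})]
    [ContMDiffVectorBundle ω F V IB] [IsManifold IB ω B] [IsManifold IZ ω Z] [T2Space B] [T2Space Z]
    (Φ : Diffeomorph (IB.prod 𝓘(ℝ, F)) IZ (TotalSpace F V) Z ω) (hΦ : ∀ p, proj (Φ p) = p.proj)
    (hlin : ∀ b, IsLinearMap ℝ fun v : V b => (⟨Φ ⟨b, v⟩, hΦ ⟨b, v⟩⟩ : proj ⁻¹' {b})) :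
    IsAnalyticVectorBundle F IB IZ proj := by
  obtain rfl : proj = TotalSpace.proj ∘ Φ.symm := funext fun z => by
    rw [Function.comp_apply, ← hΦ, Φ.apply_symm_apply]
  refine ⟨inferInstance, inferInstance, inferInstance, inferInstance, fun b => ⟨Φ ⟨b, 0⟩, hΦ _⟩,
    (contMDiff_proj V).comp Φ.symm.contMDiff,
    fun b => (trivializationAt F V b).compHomeomorph Φ.symm.toHomeomorph,
    fun b => ⟨?_, ?_, ?_, ?_⟩, fun b b' => ⟨fun x => ((trivializationAt F V b).coordChangeL ℝ
      (trivializationAt F V b') x : F →L[ℝ] F), contMDiffOn_coordChangeL _ _, fun x hx v => ?_⟩⟩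
  · exact FiberBundle.mem_baseSet_trivializationAt' b
  · exact (trivializationAt F V b).contMDiffOn.comp Φ.symm.contMDiff.contMDiffOn fun _ hz => hz
  · exact Φ.contMDiff.comp_contMDiffOn (trivializationAt F V b).contMDiffOn_symm
  · exact fun x => isLinearMap_trivialization_symm Φ.toEquiv hΦ hlin (trivializationAt F V b)
  · refine ((trivializationAt F V b).coordChangeL_apply' (R := ℝ) _ hx v).trans ?_
    exact congrArg (fun p => (trivializationAt F V b' p).2) (Φ.symm_apply_apply _).symm

end VectorBundleTransport

section TangentMap

variable {𝕜 : Type*} [NontriviallyNormedField 𝕜] {E H M E' H' M' V : Type*}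
  [NormedAddCommGroup E] [NormedSpace 𝕜 E] [TopologicalSpace H] {I : ModelWithCorners 𝕜 E H}
  [TopologicalSpace M] [ChartedSpace H M]
  [NormedAddCommGroup E'] [NormedSpace 𝕜 E'] [TopologicalSpace H'] {I' : ModelWithCorners 𝕜 E' H'}
  [TopologicalSpace M'] [ChartedSpace H' M']
  [NormedAddCommGroup V] [NormedSpace 𝕜 V] {r s : WithTop ℕ∞}

theorem contMDiffAt_tangentMap [IsManifold I 1 M] [IsManifold I' 1 M'] {f : M → M'}
    {p : TangentBundle I M} (hf : ContMDiffAt I I' s f p.proj) (hrs : r + 1 ≤ s) :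
    ContMDiffAt I.tangent I'.tangent r (tangentMap I I' f) p := by
  have hproj : ContMDiffAt I.tangent I r (fun q : TangentBundle I M => q.proj) p :=
    Bundle.contMDiffAt_proj (TangentSpace I)
  have hderiv : ContMDiffAt I.tangent 𝓘(𝕜, E →L[𝕜] E') r
      (fun q : TangentBundle I M =>
        inTangentCoordinates I I' id f (mfderiv I I' f) p.proj q.proj) p :=
    (hf.mfderiv_const hrs).comp p hproj
  exact ContMDiffAt.clm_apply_of_inCoordinates hderiv contMDiffAt_id
    ((hf.of_le (le_self_add.trans hrs)).comp p hproj)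

theorem contMDiffAt_tangentBundle_mk {g w : M → V} {z : M} (hg : ContMDiffAt I 𝓘(𝕜, V) r g z)
    (hw : ContMDiffAt I 𝓘(𝕜, V) r w z) :
    ContMDiffAt I 𝓘(𝕜, V).tangent r
      (fun z => (⟨g z, w z⟩ : TangentBundle 𝓘(𝕜, V) V)) z :=
  (Bundle.contMDiffAt_totalSpace (F := V) (E := TangentSpace 𝓘(𝕜, V) (M := V))).2
    ⟨hg, by simpa only [trivializationAt_model_space_apply] using hw⟩

theorem tangentMap_eq_self {f : M → M} {p : TangentBundle I M} (h : f =ᶠ[𝓝 p.proj] id) :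
    tangentMap I I f p = p :=
  Bundle.TotalSpace.ext h.self_of_nhds
    (heq_of_eq (DFunLike.congr_fun (h.mfderiv_eq.trans mfderiv_id) p.2))

theorem mul_mfderiv_add_mfderiv_mul_of_isIdempotentElem {A : Type*} [NormedRing A]
    [NormedAlgebra 𝕜 A] {f : M → A} (hf : ∀ x, IsIdempotentElem (f x)) {x : M}
    {f' : TangentSpace I x →L[𝕜] A} (h : HasMFDerivAt I 𝓘(𝕜, A) f x f') (v : TangentSpace I x) :
    f x * f' v + f' v * f x = f' v := by
  have hsq : HasMFDerivAt I 𝓘(𝕜, A) f x (f x • f' + MulOpposite.op (f x) • f') :=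
    (h.mul' h).congr_of_eventuallyEq (.of_forall fun y => (hf y).symm)
  exact DFunLike.congr_fun (hasMFDerivAt_unique hsq h) v

theorem exists_mfderiv_eq_fderiv_comp {W : Type*} [NormedAddCommGroup W] [NormedSpace 𝕜 W]
    {g : M → W} {f : V → M} {x : M} {a : V} (hg : MDifferentiableAt I 𝓘(𝕜, W) g x)
    (hf : MDifferentiableAt 𝓘(𝕜, V) I f a) (hx : f a = x) (b : V) :
    ∃ v : TangentSpace I x, mfderiv I 𝓘(𝕜, W) g x v = fderiv 𝕜 (g ∘ f) a b := by
  subst hx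
  exact ⟨mfderiv 𝓘(𝕜, V) I f a b, by rw [← mfderiv_eq_fderiv, mfderiv_comp a hg hf]; rfl⟩

end TangentMap

/-! ### Analyticity of the quotient maps and of the idempotents -/

section MatrixAnalysis

/-- The operator norm for the sup norm on `ℝⁿ`, with its topology replaced by the product topology
of the entries: the two agree, but not by unfolding instances. -/
noncomputable local instance matrixNormedRing {n : ℕ} : NormedRing (Matrix (Fin n) (Fin n) ℝ) :=
  { Matrix.linftyOpNormedRing with
    toMetricSpace :=
      (Matrix.linftyOpNormedRing (n := Fin n) (α := ℝ)).toMetricSpace.replaceTopology rfl }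

noncomputable local instance matrixNormedAlgebra {n : ℕ} :
    NormedAlgebra ℝ (Matrix (Fin n) (Fin n) ℝ) where
  norm_smul_le := (Matrix.linftyOpNormedAlgebra (R := ℝ) (n := Fin n) (α := ℝ)).norm_smul_le

local instance matrixCompleteSpace {n : ℕ} : CompleteSpace (Matrix (Fin n) (Fin n) ℝ) :=
  FiniteDimensional.complete ℝ _

variable {n k : ℕ}

section MatrixValuedMaps

variable {E : Type*} [NormedAddCommGroup E] [NormedSpace ℝ E] {r : WithTop ℕ∞}

theorem contDiffAt_matrix {f : E → Matrix (Fin n) (Fin n) ℝ} {x : E} :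
    ContDiffAt ℝ r f x ↔ ∀ i j, ContDiffAt ℝ r (fun x => f x i j) x := by
  rw [← (Matrix.ofLinearEquiv ℝ).symm.toContinuousLinearEquiv.comp_contDiffAt_iff]
  simp only [contDiffAt_pi]
  rfl

theorem contDiffAt_matrix_apply (A : Matrix (Fin n) (Fin n) ℝ) (i j : Fin n) :
    ContDiffAt ℝ r (fun A : Matrix (Fin n) (Fin n) ℝ => A i j) A :=
  contDiffAt_matrix.1 contDiffAt_id i j

theorem contDiff_matrixOf :
    ContDiff ℝ r (Matrix.of : (Fin n → Fin n → ℝ) → Matrix (Fin n) (Fin n) ℝ) :=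
  contDiff_iff_contDiffAt.2 fun _ => contDiffAt_matrix.2 fun i j =>
    (contDiff_apply_apply ℝ ℝ i j).contDiffAt

theorem contDiff_matrixOf_symm :
    ContDiff ℝ r (Matrix.of.symm : Matrix (Fin n) (Fin n) ℝ → Fin n → Fin n → ℝ) :=
  contDiff_iff_contDiffAt.2 fun A => contDiffAt_pi.2 fun i => contDiffAt_pi.2 fun j =>
    contDiffAt_matrix_apply A i j

theorem contDiff_matrixTranspose :
    ContDiff ℝ r (Matrix.transpose : Matrix (Fin n) (Fin n) ℝ → Matrix (Fin n) (Fin n) ℝ) :=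
  (Matrix.transposeLinearEquiv (Fin n) (Fin n) ℝ ℝ).toContinuousLinearEquiv.contDiff

theorem contDiffAt_matrix_inv (A : GL (Fin n) ℝ) :
    ContDiffAt ℝ r (fun A : Matrix (Fin n) (Fin n) ℝ => A⁻¹) A.1 := by
  simpa only [Matrix.nonsing_inv_eq_ringInverse] using contDiffAt_ringInverse ℝ A

theorem eventually_det_ne_zero {A : Matrix (Fin n) (Fin n) ℝ} (hA : A.det ≠ 0) :
    ∀ᶠ B in 𝓝 A, B.det ≠ 0 :=
  continuous_id.matrix_det.continuousAt.eventually_ne hA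

theorem toGL_coe (W : GL (Fin n) ℝ) : toGL W.1 = W :=
  Units.ext (toGL_val W.det_ne_zero)

theorem contDiffAt_toGL {A : Matrix (Fin n) (Fin n) ℝ} (hA : A.det ≠ 0) :
    ContDiffAt ℝ r (fun A : Matrix (Fin n) (Fin n) ℝ => (toGL A).1) A :=
  contDiffAt_id.congr_of_eventuallyEq ((eventually_det_ne_zero hA).mono fun _ => toGL_val)

theorem contDiffAt_gramSchmidt {V ι : Type*} [NormedAddCommGroup V]
    [InnerProductSpace ℝ V] [LinearOrder ι] [LocallyFiniteOrderBot ι] [WellFoundedLT ι]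
    {v : E → ι → V} {a : E} (hv : ∀ j, ContDiffAt ℝ r (fun y => v y j) a)
    (h : LinearIndependent ℝ (v a)) (j : ι) :
    ContDiffAt ℝ r (fun y => InnerProductSpace.gramSchmidt ℝ (v y) j) a := by
  induction j using WellFoundedLT.induction with
  | ind j ih =>
  simp only [fun y => InnerProductSpace.gramSchmidt_def ℝ (v y) j,
    Submodule.starProjection_singleton]
  refine (hv j).sub (ContDiffAt.sum fun i hi => ?_)
  have hi' := ih i (Finset.mem_Iio.1 hi)
  have hne := InnerProductSpace.gramSchmidt_ne_zero i h
  refine ContDiffAt.smul (ContDiffAt.div (hi'.inner ℝ (hv j)) ?_ ?_) hi'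
  · exact (hi'.norm ℝ hne).pow 2
  · simpa using hne

theorem contDiffAt_gramSchmidtNormed {V ι : Type*} [NormedAddCommGroup V]
    [InnerProductSpace ℝ V] [LinearOrder ι] [LocallyFiniteOrderBot ι] [WellFoundedLT ι]
    {v : E → ι → V} {a : E} (hv : ∀ j, ContDiffAt ℝ r (fun y => v y j) a)
    (h : LinearIndependent ℝ (v a)) (j : ι) :
    ContDiffAt ℝ r (fun y => InnerProductSpace.gramSchmidtNormed ℝ (v y) j) a := by
  have hj := contDiffAt_gramSchmidt hv h j
  have hne := InnerProductSpace.gramSchmidt_ne_zero j h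
  exact ((hj.norm ℝ hne).inv (norm_ne_zero_iff.2 hne)).smul hj

theorem contDiffAt_gsMatrix (W : GL (Fin n) ℝ) : ContDiffAt ℝ r gsMatrix W.1 := by
  have hcol (j : Fin n) : ContDiffAt ℝ r (fun A : Matrix (Fin n) (Fin n) ℝ => colVec A j) W.1 :=
    contDiffAt_piLp' 2 fun i => contDiffAt_matrix_apply _ i j
  exact contDiffAt_matrix.2 fun i j =>
    contDiffAt_pi.1 ((PiLp.contDiff_ofLp (p := 2)).contDiffAt.comp _
      (contDiffAt_gramSchmidtNormed hcol (linearIndependent_colVec W) j)) i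

theorem gramSchmidtGL_one : gramSchmidtGL (1 : GL (Fin n) ℝ) = 1 := by
  have ho : Orthonormal ℝ (colVec (1 : Matrix (Fin n) (Fin n) ℝ)) := by
    refine orthonormal_iff_ite.2 fun i j => ?_
    simp [inner_eq_sum, colVec, Matrix.one_apply, eq_comm]
  refine Subtype.ext (Matrix.ext fun i j => ?_)
  change InnerProductSpace.gramSchmidtNormed ℝ (colVec 1) j i =
    (1 : Matrix (Fin n) (Fin n) ℝ) i j
  rw [InnerProductSpace.gramSchmidtNormed, InnerProductSpace.gramSchmidt_of_orthogonal ℝ ho.2,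
    ho.1 j]
  simp [colVec]

theorem contDiffAt_gramSchmidtGL_toGL (W : GL (Fin n) ℝ) :
    ContDiffAt ℝ r (fun A : Matrix (Fin n) (Fin n) ℝ => (gramSchmidtGL (toGL A)).1) W.1 := by
  refine ContDiffAt.comp (g := gsMatrix) _ ?_ (contDiffAt_toGL W.det_ne_zero)
  rw [toGL_coe]
  exact contDiffAt_gsMatrix W

end MatrixValuedMaps

theorem contDiff_glue : ContDiff ℝ ω (glue : ModelGL n k → Matrix (Fin n) (Fin n) ℝ) := by
  refine contDiff_iff_contDiffAt.2 fun p => contDiffAt_matrix.2 fun i j => ?_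
  simpa only [Matrix.one_mul] using (contDiff_mul_glue (k := k) 1 i j).contDiffAt (x := p)

variable {E H M : Type*} [NormedAddCommGroup E] [NormedSpace ℝ E] [TopologicalSpace H]
  {I : ModelWithCorners ℝ E H} [TopologicalSpace M] [ChartedSpace H M] {z : M}

theorem contMDiffAt_mkGL {f : M → GL (Fin n) ℝ}
    (hf : ContMDiffAt I 𝓘(ℝ, Matrix (Fin n) (Fin n) ℝ) ω (fun z => (f z).1) z) :
    ContMDiffAt I 𝓘(ℝ, ModelGL n k) ω (fun z => (f z : GLQuot n k)) z := by
  set W : GL (Fin n) ℝ := Quotient.out (f z : GLQuot n k)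
  obtain ⟨hA, hD⟩ : (blkA k (W⁻¹ * f z).1).det ≠ 0 ∧ (blkD k (W⁻¹ * f z).1).det ≠ 0 :=
    mem_chart_source (ModelGL n k) (f z : GLQuot n k)
  have hWf : ContMDiffAt I 𝓘(ℝ, Matrix (Fin n) (Fin n) ℝ) ω (fun z => (W⁻¹ * f z).1) z :=
    (contDiff_const.mul contDiff_id).contMDiff.contMDiffAt.comp z hf
  have hslope : ContDiffAt ℝ ω (fun A => (slopeLow k A, slopeHigh k A)) (W⁻¹ * f z).1 :=
    (contDiffAt_slopeLow (contDiffAt_matrix_apply _) hA).prodMk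
      (contDiffAt_slopeHigh (contDiffAt_matrix_apply _) hD)
  refine contMDiffAt_iff_target.2 ⟨?_, hslope.contMDiffAt.comp
    (g := fun A => (slopeLow k A, slopeHigh k A)) (f := fun z => (W⁻¹ * f z).1) z hWf⟩
  exact QuotientGroup.continuous_mk.continuousAt.comp
    (Units.isOpenEmbedding_val.toIsInducing.continuousAt_iff.2 hf.continuousAt)

theorem contMDiffAt_mkO {f : M → Matrix.orthogonalGroup (Fin n) ℝ}
    (hf : ContMDiffAt I 𝓘(ℝ, Matrix (Fin n) (Fin n) ℝ) ω (fun z => (f z).1) z) :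
    ContMDiffAt I 𝓘(ℝ, ModelO n k) ω (fun z => (f z : OQuot n k)) z := by
  set V : Matrix.orthogonalGroup (Fin n) ℝ := Quotient.out (f z : OQuot n k)
  have hA : (blkA k (V⁻¹ * f z).1).det ≠ 0 := mem_chart_source (ModelO n k) (f z : OQuot n k)
  have hVf : ContMDiffAt I 𝓘(ℝ, Matrix (Fin n) (Fin n) ℝ) ω (fun z => (V⁻¹ * f z).1) z :=
    (contDiff_const.mul contDiff_id).contMDiff.contMDiffAt.comp z hf
  have hslope : ContDiffAt ℝ ω (slopeLow k) (V⁻¹ * f z).1 :=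
    contDiffAt_slopeLow (contDiffAt_matrix_apply _) hA
  refine contMDiffAt_iff_target.2
    ⟨?_, hslope.contMDiffAt.comp (f := fun z => (V⁻¹ * f z).1) z hVf⟩
  exact QuotientGroup.continuous_mk.continuousAt.comp
    (Topology.IsInducing.subtypeVal.continuousAt_iff.2 hf.continuousAt)

theorem glue_zero : glue (0 : ModelGL n k) = 1 := by
  ext i j
  simp only [glue, Matrix.of_apply, Matrix.one_apply]
  split_ifs <;> first | rfl | (subst_vars; contradiction)

theorem contMDiffAt_mk_toGL (W : GL (Fin n) ℝ) :
    ContMDiffAt 𝓘(ℝ, Matrix (Fin n) (Fin n) ℝ) 𝓘(ℝ, ModelGL n k) ω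
      (fun A => (toGL A : GLQuot n k)) W.1 :=
  contMDiffAt_mkGL (contDiffAt_toGL W.det_ne_zero).contMDiffAt

theorem contMDiffAt_mk_gramSchmidtGL_toGL (W : GL (Fin n) ℝ) :
    ContMDiffAt 𝓘(ℝ, Matrix (Fin n) (Fin n) ℝ) 𝓘(ℝ, ModelO n k) ω
      (fun A => (gramSchmidtGL (toGL A) : OQuot n k)) W.1 :=
  contMDiffAt_mkO (contDiffAt_gramSchmidtGL_toGL W).contMDiffAt

theorem mk_mem_chartGL_source (W : GL (Fin n) ℝ) : (W : GLQuot n k) ∈ (chartGL W).source := by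
  change (blkA k (W⁻¹ * W).1).det ≠ 0 ∧ (blkD k (W⁻¹ * W).1).det ≠ 0
  rw [inv_mul_cancel, Units.val_one, ← glue_zero (k := k), blkA_glue, blkD_glue, Matrix.det_one,
    Matrix.det_one]
  exact ⟨one_ne_zero, one_ne_zero⟩

theorem mk_mem_chartO_source (V : Matrix.orthogonalGroup (Fin n) ℝ) :
    (V : OQuot n k) ∈ (chartO V).source := by
  change (blkA k (V⁻¹ * V).1).det ≠ 0
  rw [inv_mul_cancel, OneMemClass.coe_one, ← glue_zero (k := k), blkA_glue, Matrix.det_one]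
  exact one_ne_zero

theorem chartGL_mk_self (W : GL (Fin n) ℝ) : chartGL W (W : GLQuot n k) = 0 := by
  change (slopeLow k (W⁻¹ * W).1, slopeHigh k (W⁻¹ * W).1) = 0
  rw [inv_mul_cancel, Units.val_one, ← glue_zero (k := k), slopeLow, slopeHigh, blkC_glue,
    blkB_glue]
  exact Prod.ext (Matrix.zero_mul _) (Matrix.zero_mul _)

theorem chartO_mk_self (V : Matrix.orthogonalGroup (Fin n) ℝ) :
    chartO V (V : OQuot n k) = 0 := by
  change slopeLow k (V⁻¹ * V).1 = 0
  rw [inv_mul_cancel, OneMemClass.coe_one, ← glue_zero (k := k), slopeLow, blkC_glue]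
  exact Matrix.zero_mul _

/-- The local section of `GL_n(ℝ) → GL_n(ℝ) / (GL_k × GL_{n-k})` through `W` given by the chart
`chartGL W`. -/
noncomputable def sectionGL (W : GL (Fin n) ℝ) (y : GLQuot n k) : GL (Fin n) ℝ :=
  W * toGL (glue (chartGL W y))

/-- The local section of `O_n → O_n / (O_k × O_{n-k})` through `V` given by the chart
`chartO V`. -/
noncomputable def sectionO (V : Matrix.orthogonalGroup (Fin n) ℝ) (x : OQuot n k) :
    Matrix.orthogonalGroup (Fin n) ℝ :=
  V * gramSchmidtGL (toGL (glue (chartO V x, 0)))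

theorem sectionGL_mk_self (W : GL (Fin n) ℝ) : sectionGL W (W : GLQuot n k) = W := by
  rw [sectionGL, chartGL_mk_self, glue_zero, ← Units.val_one, toGL_coe, mul_one]

theorem sectionO_mk_self (V : Matrix.orthogonalGroup (Fin n) ℝ) :
    sectionO V (V : OQuot n k) = V := by
  rw [sectionO, chartO_mk_self, ← Prod.zero_eq_mk, glue_zero, ← Units.val_one, toGL_coe,
    gramSchmidtGL_one, mul_one]

theorem mk_sectionGL {W : GL (Fin n) ℝ} {y : GLQuot n k} (hy : y ∈ (chartGL W).source) :
    (sectionGL W y : GLQuot n k) = y := by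
  have h : (W⁻¹)⁻¹ • (toGL (glue (chartGL W y)) : GLQuot n k) = y := (chartGL W).left_inv hy
  rwa [inv_inv] at h

theorem mk_sectionO {V : Matrix.orthogonalGroup (Fin n) ℝ} {x : OQuot n k}
    (hx : x ∈ (chartO V).source) : (sectionO V x : OQuot n k) = x := by
  have h : (V⁻¹)⁻¹ • (gramSchmidtGL (toGL (glue (chartO V x, 0))) : OQuot n k) = x :=
    (chartO V).left_inv hx
  rwa [inv_inv] at h

theorem contMDiffAt_sectionGL (W : GL (Fin n) ℝ) :
    ContMDiffAt 𝓘(ℝ, ModelGL n k) 𝓘(ℝ, Matrix (Fin n) (Fin n) ℝ) ω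
      (fun y : GLQuot n k => (sectionGL W y).1) W := by
  have hchart : ContMDiffAt 𝓘(ℝ, ModelGL n k) 𝓘(ℝ, ModelGL n k) ω (chartGL W) (W : GLQuot n k) :=
    contMDiffAt_of_mem_maximalAtlas (IsManifold.subset_maximalAtlas ⟨W, rfl⟩)
      (mk_mem_chartGL_source W)
  have htoGL : ContDiffAt ℝ ω (fun p : ModelGL n k => (toGL (glue p)).1)
      (chartGL W (W : GLQuot n k)) := by
    refine ContDiffAt.comp (f := glue) _ (contDiffAt_toGL ?_) contDiff_glue.contDiffAt
    rw [chartGL_mk_self, glue_zero, Matrix.det_one]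
    exact one_ne_zero
  have hmul : ContDiffAt ℝ ω (fun p : ModelGL n k => W.1 * (toGL (glue p)).1)
      (chartGL W (W : GLQuot n k)) := contDiffAt_const.mul htoGL
  exact hmul.contMDiffAt.comp _ hchart

theorem contMDiffAt_sectionO (V : Matrix.orthogonalGroup (Fin n) ℝ) :
    ContMDiffAt 𝓘(ℝ, ModelO n k) 𝓘(ℝ, Matrix (Fin n) (Fin n) ℝ) ω
      (fun x : OQuot n k => (sectionO V x).1) V := by
  have hchart : ContMDiffAt 𝓘(ℝ, ModelO n k) 𝓘(ℝ, ModelO n k) ω (chartO V) (V : OQuot n k) :=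
    contMDiffAt_of_mem_maximalAtlas (IsManifold.subset_maximalAtlas ⟨V, rfl⟩)
      (mk_mem_chartO_source V)
  have hglue : ContDiff ℝ ω (fun T : ModelO n k => glue (T, 0)) :=
    contDiff_glue.comp (contDiff_id.prodMk contDiff_const)
  have hgs : ContDiffAt ℝ ω (fun T : ModelO n k => (gramSchmidtGL (toGL (glue (T, 0)))).1)
      (chartO V (V : OQuot n k)) := by
    refine ContDiffAt.comp (g := fun A => (gramSchmidtGL (toGL A)).1) _ ?_ hglue.contDiffAt
    rw [← toGL_val (det_glue_zero (chartO V (V : OQuot n k)))]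
    exact contDiffAt_gramSchmidtGL_toGL _
  have hmul : ContDiffAt ℝ ω (fun T : ModelO n k => V.1 * (gramSchmidtGL (toGL (glue (T, 0)))).1)
      (chartO V (V : OQuot n k)) := contDiffAt_const.mul hgs
  exact hmul.contMDiffAt.comp _ hchart

section Submersion

variable {S X F : Type} [TopologicalSpace S] [TopologicalSpace X] [NormedAddCommGroup F]
  [NormedSpace ℝ F] [ChartedSpace F X] {j : S → Matrix (Fin n) (Fin n) ℝ} {π : S → X}

theorem isAnalyticSubmersion_of_sections {f : Matrix (Fin n) (Fin n) ℝ → X}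
    (hf : ∀ s, ContMDiffAt 𝓘(ℝ, Matrix (Fin n) (Fin n) ℝ) 𝓘(ℝ, F) ω f (j s))
    (hfj : ∀ s, f (j s) = π s) {τ : S → X → S} (hτ : ∀ s, τ s (π s) = s)
    (hjτ : ∀ s,
      ContMDiffAt 𝓘(ℝ, F) 𝓘(ℝ, Matrix (Fin n) (Fin n) ℝ) ω (fun x => j (τ s x)) (π s))
    (hπτ : ∀ s, ∀ᶠ x in 𝓝 (π s), π (τ s x) = x) :
    IsAnalyticSubmersion (E := F) (fun s a b => j s a b) π := by
  refine fun s => ⟨⟨f ∘ Matrix.of, ?_, .of_forall hfj⟩, τ s, hτ s, ?_, hπτ s⟩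
  · exact (hf s).comp (Matrix.of.symm (j s)) contDiff_matrixOf.contMDiff.contMDiffAt
  · exact contDiff_matrixOf_symm.contMDiff.contMDiffAt.comp _ (hjτ s)

theorem IsAnalyticSubmersion.contMDiffAt_of_comp
    (hπ : IsAnalyticSubmersion (E := F) (fun s a b => j s a b) π) {g : X → M}
    {h : Matrix (Fin n) (Fin n) ℝ → M} (hg : ∀ s, h (j s) = g (π s)) {s : S}
    (hh : ContMDiffAt 𝓘(ℝ, Matrix (Fin n) (Fin n) ℝ) I ω h (j s)) :
    ContMDiffAt 𝓘(ℝ, F) I ω g (π s) := by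
  obtain ⟨-, τ, hτ, hjτ, hπτ⟩ := hπ s
  have hjτ' : ContMDiffAt 𝓘(ℝ, F) 𝓘(ℝ, Matrix (Fin n) (Fin n) ℝ) ω (fun x => j (τ x)) (π s) :=
    contDiff_matrixOf.contMDiff.contMDiffAt.comp (I' := 𝓘(ℝ, Fin n → Fin n → ℝ)) _ hjτ
  have hcomp : ContMDiffAt 𝓘(ℝ, F) I ω (fun x => h (j (τ x))) (π s) :=
    ContMDiffAt.comp (g := h) _ (by rwa [hτ]) hjτ'
  exact hcomp.congr_of_eventuallyEq (hπτ.mono fun x hx => ((hg (τ x)).trans (congrArg g hx)).symm)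

end Submersion

theorem isAnalyticSubmersion_mkGL :
    IsAnalyticSubmersion (E := ModelGL n k) (fun (W : GL (Fin n) ℝ) i j => W.1 i j)
      (QuotientGroup.mk : GL (Fin n) ℝ → GLQuot n k) :=
  isAnalyticSubmersion_of_sections contMDiffAt_mk_toGL (fun W => by rw [toGL_coe])
    sectionGL_mk_self contMDiffAt_sectionGL fun W =>
      ((chartGL W).open_source.eventually_mem (mk_mem_chartGL_source W)).mono fun _ => mk_sectionGL

theorem isAnalyticSubmersion_mkO :
    IsAnalyticSubmersion (E := ModelO n k)
      (fun (V : Matrix.orthogonalGroup (Fin n) ℝ) i j => V.1 i j)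
      (QuotientGroup.mk : Matrix.orthogonalGroup (Fin n) ℝ → OQuot n k) :=
  isAnalyticSubmersion_of_sections (fun V => contMDiffAt_mk_gramSchmidtGL_toGL (Unitary.toUnits V))
    (fun V => (congrArg _ (congrArg _ (toGL_coe (Unitary.toUnits V)))).trans (mk_gs_toUnits V))
    sectionO_mk_self contMDiffAt_sectionO fun V =>
      ((chartO V).open_source.eventually_mem (mk_mem_chartO_source V)).mono fun _ => mk_sectionO

theorem contMDiff_gramSchmidtMap :
    ContMDiff 𝓘(ℝ, ModelGL n k) 𝓘(ℝ, ModelO n k) ω (gramSchmidtMap n k) := by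
  refine Quotient.ind fun W => isAnalyticSubmersion_mkGL.contMDiffAt_of_comp (fun W' => ?_)
    (contMDiffAt_mk_gramSchmidtGL_toGL W)
  rw [toGL_coe]
  rfl

theorem contMDiff_idem :
    ContMDiff 𝓘(ℝ, ModelGL n k) 𝓘(ℝ, Matrix (Fin n) (Fin n) ℝ) ω (idem n k) := by
  refine Quotient.ind fun W => isAnalyticSubmersion_mkGL.contMDiffAt_of_comp
    (h := fun A => A * diagProj n k * A⁻¹) (fun W' => ?_) ?_
  · rw [← Matrix.coe_units_inv]
    rfl
  · exact ((contDiffAt_id.mul contDiffAt_const).mul (contDiffAt_matrix_inv W)).contMDiffAt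

theorem contMDiff_inclusion :
    ContMDiff 𝓘(ℝ, ModelO n k) 𝓘(ℝ, ModelGL n k) ω (inclusion n k) := by
  refine Quotient.ind fun V => isAnalyticSubmersion_mkO.contMDiffAt_of_comp (fun V' => ?_)
    (contMDiffAt_mk_toGL (Unitary.toUnits V))
  exact congrArg _ (toGL_coe (Unitary.toUnits V'))

theorem contMDiff_orthProj :
    ContMDiff 𝓘(ℝ, ModelO n k) 𝓘(ℝ, Matrix (Fin n) (Fin n) ℝ) ω (orthProj n k) := by
  rw [orthProj_eq_idem_inclusion]
  exact contMDiff_idem.comp contMDiff_inclusion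

instance t2Space_GLQuot : T2Space (GLQuot n k) :=
  T2Space.of_injective_continuous idem_injective contMDiff_idem.continuous

theorem inclusion_injective : Function.Injective (inclusion n k) :=
  Function.LeftInverse.injective gramSchmidtMap_inclusion

instance t2Space_OQuot : T2Space (OQuot n k) :=
  .of_injective_continuous inclusion_injective contMDiff_inclusion.continuous

theorem det_intertwiner_self_ne_zero {e : Matrix (Fin n) (Fin n) ℝ} (he : IsIdempotentElem e) :
    (intertwiner e e).det ≠ 0 := by
  rw [intertwiner_self he, Matrix.det_one]
  exact one_ne_zero

theorem eventually_det_intertwiner_ne_zero {e A : Matrix (Fin n) (Fin n) ℝ}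
    (h : (intertwiner A e).det ≠ 0) : ∀ᶠ B in 𝓝 A, (intertwiner B e).det ≠ 0 := by
  have hc : Continuous fun B : Matrix (Fin n) (Fin n) ℝ => intertwiner B e := by
    unfold intertwiner
    fun_prop
  exact hc.matrix_det.continuousAt.eventually_ne h

theorem contMDiffAt_idemLocalInverse {y : GLQuot n k} {A : Matrix (Fin n) (Fin n) ℝ}
    (h : (intertwiner A (idem n k y)).det ≠ 0) :
    ContMDiffAt 𝓘(ℝ, Matrix (Fin n) (Fin n) ℝ) 𝓘(ℝ, ModelGL n k) ω (idemLocalInverse y) A := by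
  obtain ⟨W, rfl⟩ := QuotientGroup.mk_surjective y
  set e := idem n k (W : GLQuot n k)
  have hc : ContDiffAt ℝ ω (fun B => intertwiner B e) A := by
    unfold intertwiner
    fun_prop
  have htoGL : ContDiffAt ℝ ω (fun B => (toGL (intertwiner B e)).1) A :=
    (contDiffAt_toGL h).comp (f := fun B => intertwiner B e) A hc
  exact contMDiffAt_mkGL (f := fun B => toGL (intertwiner B e) * W)
    (htoGL.mul contDiffAt_const).contMDiffAt

theorem contMDiffAt_of_idem {f : M → GLQuot n k}
    (hf : ContMDiffAt I 𝓘(ℝ, Matrix (Fin n) (Fin n) ℝ) ω (fun z => idem n k (f z)) z) :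
    ContMDiffAt I 𝓘(ℝ, ModelGL n k) ω f z := by
  have hdet : ∀ᶠ w in 𝓝 z, (intertwiner (idem n k (f w)) (idem n k (f z))).det ≠ 0 :=
    hf.continuousAt.eventually (eventually_det_intertwiner_ne_zero
      (det_intertwiner_self_ne_zero (isIdempotentElem_idem (f z))))
  have hcomp : ContMDiffAt I 𝓘(ℝ, ModelGL n k) ω
      (fun w => idemLocalInverse (f z) (idem n k (f w))) z :=
    (contMDiffAt_idemLocalInverse hdet.self_of_nhds).comp z hf
  exact hcomp.congr_of_eventuallyEq (hdet.mono fun w hw => (idemLocalInverse_idem hw).symm)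

/-! ### The tangent bundle -/

/-- The derivative of `orthProj n k` at `x`, with values in the space of matrices. -/
noncomputable def orthProjDeriv (x : OQuot n k) :
    TangentSpace 𝓘(ℝ, ModelO n k) x →L[ℝ] Matrix (Fin n) (Fin n) ℝ :=
  mfderiv 𝓘(ℝ, ModelO n k) 𝓘(ℝ, Matrix (Fin n) (Fin n) ℝ) (orthProj n k) x

theorem hasMFDerivAt_orthProj (x : OQuot n k) :
    HasMFDerivAt 𝓘(ℝ, ModelO n k) 𝓘(ℝ, Matrix (Fin n) (Fin n) ℝ) (orthProj n k) x
      (orthProjDeriv x) :=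
  (contMDiff_orthProj.mdifferentiable (by decide) x).hasMFDerivAt

theorem orthProj_mul_orthProjDeriv_add (x : OQuot n k) (v : TangentSpace 𝓘(ℝ, ModelO n k) x) :
    orthProj n k x * orthProjDeriv x v + orthProjDeriv x v * orthProj n k x = orthProjDeriv x v :=
  mul_mfderiv_add_mfderiv_mul_of_isIdempotentElem isIdempotentElem_orthProj
    (hasMFDerivAt_orthProj x) v

theorem orthProjDeriv_transpose (x : OQuot n k) (v : TangentSpace 𝓘(ℝ, ModelO n k) x) :
    (orthProjDeriv x v)ᵀ = orthProjDeriv x v := by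
  let T : Matrix (Fin n) (Fin n) ℝ →L[ℝ] Matrix (Fin n) (Fin n) ℝ :=
    (Matrix.transposeLinearEquiv (Fin n) (Fin n) ℝ ℝ).toLinearMap.toContinuousLinearMap
  have hT : HasMFDerivAt 𝓘(ℝ, ModelO n k) 𝓘(ℝ, Matrix (Fin n) (Fin n) ℝ) (orthProj n k) x
      (T.comp (orthProjDeriv x)) :=
    (T.hasMFDerivAt.comp x (hasMFDerivAt_orthProj x)).congr_of_eventuallyEq
      (.of_forall fun x' => (orthProj_transpose x').symm)
  exact DFunLike.congr_fun (hasMFDerivAt_unique hT (hasMFDerivAt_orthProj x)) v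

theorem orthProjDeriv_eq_add_transpose (x : OQuot n k) (v : TangentSpace 𝓘(ℝ, ModelO n k) x) :
    orthProjDeriv x v =
      orthProj n k x * orthProjDeriv x v + (orthProj n k x * orthProjDeriv x v)ᵀ := by
  rw [Matrix.transpose_mul, orthProjDeriv_transpose, orthProj_transpose,
    orthProj_mul_orthProjDeriv_add]

/-- The linear map `v ↦ orthProj x * d(orthProj)(v)`, which identifies the tangent space of
`O_n / (O_k × O_{n-k})` at `x` with the direction of the fibre of the Gram-Schmidt map. -/
noncomputable def tangentDirection (x : OQuot n k) :
    TangentSpace 𝓘(ℝ, ModelO n k) x →ₗ[ℝ] idemDirection ℝ (orthProj n k x) :=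
  (LinearMap.mulLeft ℝ (orthProj n k x) ∘ₗ (orthProjDeriv x).toLinearMap).codRestrict _ fun v =>
    mul_mem_idemDirection_of_mul_add_mul_eq (isIdempotentElem_orthProj x)
      (orthProj_mul_orthProjDeriv_add x v)

/-- An analytic local left inverse of `orthProj n k` around `orthProj n k x`, defined on all
matrices. -/
noncomputable def orthProjLocalInverse (x : OQuot n k) (A : Matrix (Fin n) (Fin n) ℝ) : OQuot n k :=
  gramSchmidtMap n k (idemLocalInverse (inclusion n k x) A)

theorem orthProjLocalInverse_orthProj {x x' : OQuot n k}
    (h : (intertwiner (orthProj n k x') (orthProj n k x)).det ≠ 0) :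
    orthProjLocalInverse x (orthProj n k x') = x' := by
  rw [orthProj_eq_idem_inclusion] at h ⊢
  exact (congrArg _ (idemLocalInverse_idem h)).trans (gramSchmidtMap_inclusion x')

theorem contMDiffAt_orthProjLocalInverse {x : OQuot n k} {A : Matrix (Fin n) (Fin n) ℝ}
    (h : (intertwiner A (orthProj n k x)).det ≠ 0) :
    ContMDiffAt 𝓘(ℝ, Matrix (Fin n) (Fin n) ℝ) 𝓘(ℝ, ModelO n k) ω (orthProjLocalInverse x) A := by
  rw [orthProj_eq_idem_inclusion] at h
  exact contMDiff_gramSchmidtMap.contMDiffAt.comp A (contMDiffAt_idemLocalInverse h)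

theorem orthProj_orthProjLocalInverse_mul {x : OQuot n k} {A : Matrix (Fin n) (Fin n) ℝ}
    (hA : IsIdempotentElem A) (h : (intertwiner A (orthProj n k x)).det ≠ 0) :
    orthProj n k (orthProjLocalInverse x A) * A = A := by
  rw [orthProj_eq_idem_inclusion] at h
  have hidem := idem_idemLocalInverse hA h
  have hmul := (gramSchmidtMap_eq_iff_mul_orthProj.1
    (rfl : gramSchmidtMap n k (idemLocalInverse (inclusion n k x) A) = _)).1
  rwa [hidem] at hmul

theorem tangentMap_orthProjLocalInverse_tangentMap_orthProj {x : OQuot n k}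
    {p : TangentBundle 𝓘(ℝ, ModelO n k) (OQuot n k)}
    (h : (intertwiner (orthProj n k p.proj) (orthProj n k x)).det ≠ 0) :
    tangentMap 𝓘(ℝ, Matrix (Fin n) (Fin n) ℝ) 𝓘(ℝ, ModelO n k) (orthProjLocalInverse x)
      (tangentMap 𝓘(ℝ, ModelO n k) 𝓘(ℝ, Matrix (Fin n) (Fin n) ℝ) (orthProj n k) p) = p := by
  have hleft : orthProjLocalInverse x ∘ orthProj n k =ᶠ[𝓝 p.proj] id :=
    (contMDiff_orthProj.continuous.continuousAt.eventually
      (eventually_det_intertwiner_ne_zero h)).mono fun _ => orthProjLocalInverse_orthProj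
  rw [← tangentMap_comp_at _ ((contMDiffAt_orthProjLocalInverse h).mdifferentiableAt (by decide))
    (contMDiff_orthProj.mdifferentiable (by decide) _), tangentMap_eq_self hleft]

theorem orthProjDeriv_injective (x : OQuot n k) : Function.Injective (orthProjDeriv x) := by
  intro v v' h
  have hx := det_intertwiner_self_ne_zero (isIdempotentElem_orthProj x)
  have hmap : tangentMap 𝓘(ℝ, ModelO n k) 𝓘(ℝ, Matrix (Fin n) (Fin n) ℝ) (orthProj n k) ⟨x, v⟩ =
      tangentMap 𝓘(ℝ, ModelO n k) 𝓘(ℝ, Matrix (Fin n) (Fin n) ℝ) (orthProj n k) ⟨x, v'⟩ :=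
    congrArg (Bundle.TotalSpace.mk _) h
  have hp : (⟨x, v⟩ : TangentBundle 𝓘(ℝ, ModelO n k) (OQuot n k)) = ⟨x, v'⟩ :=
    (tangentMap_orthProjLocalInverse_tangentMap_orthProj hx).symm.trans
      ((congrArg (tangentMap _ _ (orthProjLocalInverse x)) hmap).trans
        (tangentMap_orthProjLocalInverse_tangentMap_orthProj hx))
  exact Bundle.TotalSpace.mk_injective x hp

theorem contDiffAt_orthProj_comp_orthProjLocalInverse {x : OQuot n k}
    {A : Matrix (Fin n) (Fin n) ℝ} (h : (intertwiner A (orthProj n k x)).det ≠ 0) :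
    ContDiffAt ℝ ω (orthProj n k ∘ orthProjLocalInverse x) A :=
  (contMDiff_orthProj.contMDiffAt.comp A (contMDiffAt_orthProjLocalInverse h)).contDiffAt

/-- Transposing turns the direction of the fibre over `x` into the directions of the lines of
idempotents `A` with the same kernel as `orthProj x`; the projection with the same range as `A`
fixes `A`, and this relation is differentiated along the line. -/
theorem fderiv_orthProj_comp_orthProjLocalInverse_mul {x : OQuot n k}
    {a : Matrix (Fin n) (Fin n) ℝ} (ha : a ∈ idemDirection ℝ (orthProj n k x)) :
    fderiv ℝ (orthProj n k ∘ orthProjLocalInverse x) (orthProj n k x) aᵀ * orthProj n k x = aᵀ := by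
  have hx := det_intertwiner_self_ne_zero (isIdempotentElem_orthProj x)
  have he := isIdempotentElem_orthProj x
  have he_transpose := orthProj_transpose x
  set e := orthProj n k x
  set h := orthProj n k ∘ orthProjLocalInverse x
  have hh_e : h e = e := congrArg (orthProj n k) (orthProjLocalInverse_orthProj hx)
  let line (t : ℝ) : Matrix (Fin n) (Fin n) ℝ := e + t • aᵀ
  have hline_idem (t : ℝ) : IsIdempotentElem (line t) := by
    have hsum := isIdempotentElem_add_of_mem_idemDirection he (Submodule.smul_mem _ t ha)
    simpa only [IsIdempotentElem, line, Matrix.transpose_mul, Matrix.transpose_add,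
      Matrix.transpose_smul, he_transpose] using congrArg Matrix.transpose hsum
  have hline : HasDerivAt line aᵀ 0 :=
    (((hasDerivAt_id (0 : ℝ)).smul_const aᵀ).const_add e).congr_deriv (one_smul ℝ aᵀ)
  have hline_zero : line 0 = e := by simp only [line, zero_smul, add_zero]
  have hfix : (fun t => h (line t) * line t) =ᶠ[𝓝 0] line := by
    have hline_tendsto : Filter.Tendsto line (𝓝 0) (𝓝 e) := hline_zero ▸ hline.continuousAt
    exact (hline_tendsto.eventually (eventually_det_intertwiner_ne_zero hx)).mono
      fun t => orthProj_orthProjLocalInverse_mul (hline_idem t)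
  have hderiv : HasDerivAt (fun t => h (line t)) (fderiv ℝ h e aᵀ) 0 :=
    ((contDiffAt_orthProj_comp_orthProjLocalInverse hx).differentiableAt
      (by decide)).hasFDerivAt.comp_hasDerivAt_of_eq 0 hline hline_zero.symm
  have hmul := (hderiv.mul hline).unique (hline.congr_of_eventuallyEq hfix)
  have heat : e * aᵀ = 0 := by
    rw [← he_transpose, ← Matrix.transpose_mul, ha.2, Matrix.transpose_zero]
  simpa only [hline_zero, hh_e, heat, add_zero] using hmul

theorem tangentDirection_bijective (x : OQuot n k) : Function.Bijective (tangentDirection x) := by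
  constructor
  · intro v v' h
    have hmul : orthProj n k x * orthProjDeriv x v = orthProj n k x * orthProjDeriv x v' :=
      congrArg Subtype.val h
    refine orthProjDeriv_injective x ?_
    rw [orthProjDeriv_eq_add_transpose, hmul, ← orthProjDeriv_eq_add_transpose]
  · rintro ⟨a, ha⟩
    have hx := det_intertwiner_self_ne_zero (isIdempotentElem_orthProj x)
    obtain ⟨v, hv⟩ := exists_mfderiv_eq_fderiv_comp
      (contMDiff_orthProj.mdifferentiable (by decide) x)
      ((contMDiffAt_orthProjLocalInverse hx).mdifferentiableAt (by decide))
      (orthProjLocalInverse_orthProj hx) aᵀ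
    have hmul : orthProjDeriv x v * orthProj n k x = aᵀ :=
      (congrArg (fun B : Matrix (Fin n) (Fin n) ℝ => B * orthProj n k x) hv).trans
        (fderiv_orthProj_comp_orthProjLocalInverse_mul ha)
    refine ⟨v, Subtype.ext ?_⟩
    change orthProj n k x * orthProjDeriv x v = a
    rw [← orthProjDeriv_transpose, ← orthProj_transpose, ← Matrix.transpose_mul, hmul,
      Matrix.transpose_transpose]

/-- The identification of the tangent space of `O_n / (O_k × O_{n-k})` at `x` with the fibre of the
Gram-Schmidt map over `x`. -/
noncomputable def tangentFibreEquiv (x : OQuot n k) :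
    TangentSpace 𝓘(ℝ, ModelO n k) x ≃ₗ[ℝ] gramSchmidtMap n k ⁻¹' {x} :=
  (LinearEquiv.ofBijective _ (tangentDirection_bijective x)).trans (fibreLinearEquiv x).symm

theorem idem_tangentFibreEquiv (x : OQuot n k) (v : TangentSpace 𝓘(ℝ, ModelO n k) x) :
    idem n k (tangentFibreEquiv x v) = orthProj n k x + orthProj n k x * orthProjDeriv x v := by
  rw [← sub_eq_iff_eq_add']
  exact congrArg Subtype.val ((fibreLinearEquiv x).apply_symm_apply (tangentDirection x v))

/-- The bijection from the tangent bundle of `O_n / (O_k × O_{n-k})` onto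
`GL_n / (GL_k × GL_{n-k})` glued from the linear bijections `tangentFibreEquiv`. -/
noncomputable def tangentEquiv (n k : ℕ) :
    TangentBundle 𝓘(ℝ, ModelO n k) (OQuot n k) ≃ GLQuot n k :=
  ((⟨fun p => ⟨p.1, p.2⟩, fun p => ⟨p.1, p.2⟩, fun _ => rfl, fun _ => rfl⟩ :
      TangentBundle 𝓘(ℝ, ModelO n k) (OQuot n k) ≃ (x : OQuot n k) × TangentSpace _ x).trans
    (Equiv.sigmaCongrRight fun x => (tangentFibreEquiv x).toEquiv)).trans
    (Equiv.sigmaFiberEquiv (gramSchmidtMap n k))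

theorem gramSchmidtMap_tangentEquiv (p : TangentBundle 𝓘(ℝ, ModelO n k) (OQuot n k)) :
    gramSchmidtMap n k (tangentEquiv n k p) = p.proj :=
  (tangentFibreEquiv p.proj p.2).2

theorem idem_tangentEquiv (p : TangentBundle 𝓘(ℝ, ModelO n k) (OQuot n k)) :
    idem n k (tangentEquiv n k p) =
      orthProj n k p.proj + orthProj n k p.proj * orthProjDeriv p.proj p.2 :=
  idem_tangentFibreEquiv p.proj p.2

theorem contMDiff_tangentEquiv :
    ContMDiff 𝓘(ℝ, ModelO n k).tangent 𝓘(ℝ, ModelGL n k) ω (tangentEquiv n k) := by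
  intro p
  have hproj : ContMDiffAt 𝓘(ℝ, ModelO n k).tangent 𝓘(ℝ, Matrix (Fin n) (Fin n) ℝ) ω
      (fun p : TangentBundle 𝓘(ℝ, ModelO n k) (OQuot n k) => orthProj n k p.proj) p :=
    contMDiff_orthProj.contMDiffAt.comp p (Bundle.contMDiffAt_proj (TangentSpace 𝓘(ℝ, ModelO n k)))
  have hderiv : ContMDiffAt 𝓘(ℝ, ModelO n k).tangent 𝓘(ℝ, Matrix (Fin n) (Fin n) ℝ) ω
      (fun p : TangentBundle 𝓘(ℝ, ModelO n k) (OQuot n k) => orthProjDeriv p.proj p.2) p :=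
    (contMDiff_snd_tangentBundle_modelSpace _ _).contMDiffAt.comp p
      (contMDiffAt_tangentMap contMDiff_orthProj.contMDiffAt le_rfl)
  refine contMDiffAt_of_idem ?_
  simp only [idem_tangentEquiv]
  exact hproj.add ((contDiff_mul (𝔸 := Matrix (Fin n) (Fin n) ℝ)).contMDiff.contMDiffAt.comp p
    (hproj.prodMk_space hderiv))

theorem tangentEquiv_symm_eq_tangentMap {x : OQuot n k} {y : GLQuot n k}
    (h : (intertwiner (orthProj n k (gramSchmidtMap n k y)) (orthProj n k x)).det ≠ 0) :
    (tangentEquiv n k).symm y =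
      tangentMap 𝓘(ℝ, Matrix (Fin n) (Fin n) ℝ) 𝓘(ℝ, ModelO n k) (orthProjLocalInverse x)
        ⟨orthProj n k (gramSchmidtMap n k y),
          idem n k y - orthProj n k (gramSchmidtMap n k y) +
            (idem n k y - orthProj n k (gramSchmidtMap n k y))ᵀ⟩ := by
  obtain ⟨p, rfl⟩ := (tangentEquiv n k).surjective y
  rw [gramSchmidtMap_tangentEquiv] at h ⊢
  rw [Equiv.symm_apply_apply, idem_tangentEquiv, add_sub_cancel_left,
    ← orthProjDeriv_eq_add_transpose]
  exact (tangentMap_orthProjLocalInverse_tangentMap_orthProj h).symm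

theorem contMDiff_tangentEquiv_symm :
    ContMDiff 𝓘(ℝ, ModelGL n k) 𝓘(ℝ, ModelO n k).tangent ω (tangentEquiv n k).symm := by
  intro y
  have hdet := det_intertwiner_self_ne_zero (isIdempotentElem_orthProj (gramSchmidtMap n k y))
  have hproj : ContMDiff 𝓘(ℝ, ModelGL n k) 𝓘(ℝ, Matrix (Fin n) (Fin n) ℝ) ω
      (fun y => orthProj n k (gramSchmidtMap n k y)) :=
    contMDiff_orthProj.comp contMDiff_gramSchmidtMap
  have hdiff : ContMDiff 𝓘(ℝ, ModelGL n k) 𝓘(ℝ, Matrix (Fin n) (Fin n) ℝ) ω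
      (fun y => idem n k y - orthProj n k (gramSchmidtMap n k y)) :=
    contMDiff_idem.sub hproj
  have hmk := contMDiffAt_tangentBundle_mk (z := y) hproj.contMDiffAt
    (hdiff.add (contDiff_matrixTranspose.contMDiff.comp hdiff)).contMDiffAt
  refine ((contMDiffAt_tangentMap (contMDiffAt_orthProjLocalInverse hdet) le_rfl).comp y
    hmk).congr_of_eventuallyEq ?_
  exact (hproj.continuous.continuousAt.eventually (eventually_det_intertwiner_ne_zero hdet)).mono
    fun y => tangentEquiv_symm_eq_tangentMap

/-- The bi-analytic identification of the tangent bundle of `O_n / (O_k × O_{n-k})` with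
`GL_n / (GL_k × GL_{n-k})`. -/
noncomputable def tangentDiffeomorph (n k : ℕ) :
    Diffeomorph 𝓘(ℝ, ModelO n k).tangent 𝓘(ℝ, ModelGL n k)
      (TangentBundle 𝓘(ℝ, ModelO n k) (OQuot n k)) (GLQuot n k) ω where
  toEquiv := tangentEquiv n k
  contMDiff_toFun := contMDiff_tangentEquiv
  contMDiff_invFun := contMDiff_tangentEquiv_symm

end MatrixAnalysis

end GramSchmidtBundle

theorem mainTheorem10 (n k : ℕ) (hn : 2 ≤ n) (hk : 1 ≤ k) (hkn : k ≤ n - 1) :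
    -- the analytic structures of the two homogeneous spaces are the canonical quotient structures
    IsAnalyticSubmersion (E := ModelGL n k) (fun (W : GL (Fin n) ℝ) i j => W.1 i j)
      (QuotientGroup.mk : GL (Fin n) ℝ → GLQuot n k) ∧
    IsAnalyticSubmersion (E := ModelO n k)
      (fun (V : Matrix.orthogonalGroup (Fin n) ℝ) i j => V.1 i j)
      (QuotientGroup.mk : Matrix.orthogonalGroup (Fin n) ℝ → OQuot n k) ∧
    -- the vector space structures on the fibres: the fibre over `x` is identified, through the
    -- idempotents, with an affine space of matrices, whose origin is the orthogonal projection
    Function.Injective (idem n k) ∧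
    (∀ x : OQuot n k, idem n k '' (gramSchmidtMap n k ⁻¹' {x}) =
      {Q | Q * Q = Q ∧ LinearMap.range Q.mulVecLin = LinearMap.range (orthProj n k x).mulVecLin}) ∧
    ∃ (_ : ∀ x : OQuot n k, AddCommGroup (gramSchmidtMap n k ⁻¹' {x}))
      (_ : ∀ x : OQuot n k, Module ℝ (gramSchmidtMap n k ⁻¹' {x})),
      (∀ x : OQuot n k, IsLinearMap ℝ
        fun a : gramSchmidtMap n k ⁻¹' {x} => idem n k a.1 - orthProj n k x) ∧
      -- the Gram-Schmidt map is an analytic vector bundle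
      IsAnalyticVectorBundle (ModelO n k) 𝓘(ℝ, ModelO n k) 𝓘(ℝ, ModelGL n k)
        (gramSchmidtMap n k) ∧
      -- it is bi-analytically identified with the tangent bundle
      ∃ (Φ : Diffeomorph 𝓘(ℝ, ModelO n k).tangent 𝓘(ℝ, ModelGL n k)
          (TangentBundle 𝓘(ℝ, ModelO n k) (OQuot n k)) (GLQuot n k) ω)
        (hΦ : ∀ v : TangentBundle 𝓘(ℝ, ModelO n k) (OQuot n k),
          gramSchmidtMap n k (Φ v) = v.proj),
        ∀ x : OQuot n k, IsLinearMap ℝ fun v : TangentSpace 𝓘(ℝ, ModelO n k) x =>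
          (⟨Φ ⟨x, v⟩, hΦ ⟨x, v⟩⟩ : gramSchmidtMap n k ⁻¹' {x}) := by
  have hlinear (x : OQuot n k) : IsLinearMap ℝ fun v : TangentSpace 𝓘(ℝ, ModelO n k) x =>
      (⟨tangentDiffeomorph n k ⟨x, v⟩, gramSchmidtMap_tangentEquiv ⟨x, v⟩⟩ :
        gramSchmidtMap n k ⁻¹' {x}) :=
    (tangentFibreEquiv x).toLinearMap.isLinear
  exact ⟨isAnalyticSubmersion_mkGL, isAnalyticSubmersion_mkO, idem_injective, idem_image_fibre,
    fibreAddCommGroup, fibreModule, isLinearMap_idem_sub_orthProj,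
    isAnalyticVectorBundle_of_diffeomorph (tangentDiffeomorph n k) gramSchmidtMap_tangentEquiv
      hlinear,
    tangentDiffeomorph n k, gramSchmidtMap_tangentEquiv, hlinear⟩
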